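/- Let $A$ be a finite-dimensional unital real $*$-algebra which is $*$-isomorphic to a $*$-closed unital real subalgebra of some $M_n(\mathbb{C})$ (equivalently, by Wedderburn's theorem, to a finite direct sum of matrix algebras $M_{N_i}(\mathbb{F}_i)$, $\mathbb{F}_i\in\{\mathbb{R},\mathbb{C},\mathbb{H}\}$, with the conjugate transpose as involution). Let $\pi\colon A\to B(\mathcal{H})$ be a unital real-linear $*$-representation of $A$ on a finite-dimensional complex Hilbert space $\mathcal{H}$, and put $$u(A)=\{X\in A : X^*=-X\},\qquad su(A)=\{X\in u(A) : \operatorname{tr}_{\mathcal{H}}\pi(X)=0\},$$ which are real Lie algebras under the commutator. Assume that the unimodularity condition $\operatorname{tr}_{\mathcal{H}}\pi(X)=0$ is not vacuous, i.e. $\operatorname{tr}_{\mathcal{H}}\pi(X)\neq 0$ for some $X\in u(A)$. If, as real Lie algebras, $$su(A)\cong su(3)\oplus su(2)\oplus u(1),$$ then there are an integer $k\ge 0$ and an isomorphism of real $*$-algebras $A\cong B\oplus\mathbb{R}^k$, where $B$ is one of the five algebras 1. $M_3(\mathbb{C})\oplus\mathbb{H}\oplus M_2(\mathbb{R})$, 2.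 $M_3(\mathbb{C})\oplus M_3(\mathbb{R})\oplus M_2(\mathbb{R})$, 3. $M_3(\mathbb{C})\oplus\mathbb{H}\oplus\mathbb{C}$, 4. $M_3(\mathbb{C})\oplus M_2(\mathbb{C})$, 5. $M_3(\mathbb{C})\oplus M_3(\mathbb{R})\oplus\mathbb{C}$. -/

import Mathlib

open scoped Quaternion

attribute [local instance 100] LieRing.ofAssociativeRing

/-- A real `*`-algebra that is (isomorphic to) a `*`-closed unital real algebra of complex square
matrices. -/
def IsMatrixStarAlgebra (A : Type*) [Ring A] [StarRing A] [Algebra ℝ A] : Prop :=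
  ∃ (n : ℕ) (ρ : A →⋆ₐ[ℝ] Matrix (Fin n) (Fin n) ℂ), Function.Injective ρ

section Gauge

/-- `u(A) = {X ∈ A : X* = -X}`, with the commutator bracket. -/
def unitaryLie (A : Type*) [Ring A] [StarRing A] [Algebra ℝ A] [StarModule ℝ A] :
    LieSubalgebra ℝ A where
  carrier := {X | star X = -X}
  add_mem' := by
    intro X Y hX hY
    simp only [Set.mem_ofPred_eq] at *
    rw [star_add, hX, hY, neg_add]
  zero_mem' := by simp
  smul_mem' := by
    intro c X hX
    simp only [Set.mem_ofPred_eq] at *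
    rw [star_smul, hX, star_trivial, smul_neg]
  lie_mem' := by
    intro X Y hX hY
    change star X = -X at hX
    change star Y = -Y at hY
    change star ⁅X, Y⁆ = -⁅X, Y⁆
    rw [Ring.lie_def, star_sub, star_mul, star_mul, hX, hY]
    simp

variable {A : Type*} [Ring A] [StarRing A] [Algebra ℝ A]
variable {H : Type*} [NormedAddCommGroup H] [InnerProductSpace ℂ H] [CompleteSpace H]

/-- The trace over `H` of the operator by which `X ∈ A` acts. -/
noncomputable def reprTrace (π : A →⋆ₐ[ℝ] (H →L[ℂ] H)) (X : A) : ℂ :=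
  LinearMap.trace ℂ H (π X : H →ₗ[ℂ] H)

/-- `su(A) = {X ∈ u(A) : tr_H X = 0}`, with the commutator bracket. -/
noncomputable def specialUnitaryLie [StarModule ℝ A] (π : A →⋆ₐ[ℝ] (H →L[ℂ] H)) :
    LieSubalgebra ℝ A where
  carrier := {X | X ∈ unitaryLie A ∧ reprTrace π X = 0}
  add_mem' := by
    rintro X Y ⟨hX, hX'⟩ ⟨hY, hY'⟩
    refine ⟨add_mem hX hY, ?_⟩
    unfold reprTrace at *
    rw [map_add, ContinuousLinearMap.toLinearMap_add, map_add, hX', hY', add_zero]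
  zero_mem' := ⟨zero_mem _, by simp [reprTrace]⟩
  smul_mem' := by
    rintro c X ⟨hX, hX'⟩
    refine ⟨(unitaryLie A).smul_mem c hX, ?_⟩
    unfold reprTrace at *
    have h : ((π (c • X) : H →L[ℂ] H) : H →ₗ[ℂ] H) = (c : ℂ) • ((π X : H →L[ℂ] H) : H →ₗ[ℂ] H) := by
      rw [map_smul]
      ext v
      simp
    rw [h, map_smul, hX', smul_zero]
  lie_mem' := by
    rintro X Y ⟨hX, _⟩ ⟨hY, _⟩
    refine ⟨(unitaryLie A).lie_mem hX hY, ?_⟩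
    unfold reprTrace
    have h : ((π ⁅X, Y⁆ : H →L[ℂ] H) : H →ₗ[ℂ] H) =
        ((π X : H →L[ℂ] H) : H →ₗ[ℂ] H) * ((π Y : H →L[ℂ] H) : H →ₗ[ℂ] H) -
        ((π Y : H →L[ℂ] H) : H →ₗ[ℂ] H) * ((π X : H →L[ℂ] H) : H →ₗ[ℂ] H) := by
      rw [Ring.lie_def, map_sub, map_mul, map_mul]
      rfl
    rw [h, map_sub, LinearMap.trace_mul_comm, sub_self]

end Gauge

/-- The Lie algebra `u(n)` of skew-Hermitian complex `n × n` matrices. -/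
noncomputable def uLie (n : ℕ) : LieSubalgebra ℝ (Matrix (Fin n) (Fin n) ℂ) :=
  unitaryLie (Matrix (Fin n) (Fin n) ℂ)

/-- The Lie algebra `su(n)` of traceless skew-Hermitian complex `n × n` matrices. -/
noncomputable def suLie (n : ℕ) : LieSubalgebra ℝ (Matrix (Fin n) (Fin n) ℂ) where
  carrier := {X | X ∈ uLie n ∧ X.trace = 0}
  add_mem' := by
    rintro X Y ⟨hX, hX'⟩ ⟨hY, hY'⟩
    exact ⟨add_mem hX hY, by rw [Matrix.trace_add, hX', hY', add_zero]⟩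
  zero_mem' := ⟨zero_mem _, Matrix.trace_zero _ _⟩
  smul_mem' := by
    rintro c X ⟨hX, hX'⟩
    exact ⟨(uLie n).smul_mem c hX, by rw [Matrix.trace_smul, hX', smul_zero]⟩
  lie_mem' := by
    rintro X Y ⟨hX, _⟩ ⟨hY, _⟩
    refine ⟨(uLie n).lie_mem hX hY, ?_⟩
    rw [Ring.lie_def, Matrix.trace_sub, Matrix.trace_mul_comm, sub_self]

/-- `A` is `*`-isomorphic to `B` up to extra summands `ℝ`: `A ≅ B ⊕ ℝ^k` for some `k ≥ 0`.
The involution of a product is componentwise, that of `ℝ` trivial. -/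
def IsoModuloReals (A B : Type*) [Ring A] [StarRing A] [Algebra ℝ A]
    [Ring B] [StarRing B] [Algebra ℝ B] : Prop :=
  ∃ k : ℕ, Nonempty (A ≃⋆ₐ[ℝ] (B × (Fin k → ℝ)))

/-! Of the isomorphism with su(3) ⊕ su(2) ⊕ u(1), two numbers suffice: su(A) has dimension 12 and
its centre has dimension 1. Let τ be the real part of a faithful matrix trace. The form -τ(XY) is
positive definite and invariant on u(A), so the functional Im tr_H is represented by some T in the
centre of u(A) (`IsPositiveTrace.exists_central`). It is nonzero by assumption, so T is not
traceless and u(A) = su(A) ⊕ ℝT with T central. Hence u(A) has dimension 13 and its centre has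
dimension 2.

On the other side, A is a product of matrix algebras over ℝ, ℂ, ℍ (`exists_starAlgEquiv_pi_matrix`).
This is proved with the involution built in: 1 is a sum of orthogonal minimal projections, the
corner of each is ℝ, ℂ or ℍ by a Clifford-type argument, and partial isometries between equivalent
projections serve as matrix units.

Both numbers are additive over blocks, so the dimensions of the blocks modulo their centres add up
to 13 - 2 = 11. A block contributing at most 11 contributes 0, 3, 6, 8 or 10, and 11 is a sum of
such numbers only as 8 + 3 and zeros. The 8 is M_3(ℂ), which uses one dimension of centre. The 3 and
the other central dimension come from M_2(ℂ) alone, or from ℍ or M_3(ℝ) together with ℂ or M_2(ℝ).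
Every other block is ℝ. -/

instance : StarModule ℝ ℍ[ℝ] := ⟨fun r x => by ext <;> simp⟩

/-- The three finite-dimensional real division algebras. -/
inductive DivKind
  | real
  | complex
  | quaternion

/-! ### Real division algebras with their involutions -/

namespace DivKind

/-- The division algebra of a given kind. -/
def carrier : DivKind → Type
  | real => ℝ
  | complex => ℂ
  | quaternion => ℍ[ℝ]

noncomputable instance (k : DivKind) : DivisionRing k.carrier :=
  match k with
  | real => inferInstanceAs (DivisionRing ℝ)
  | complex => inferInstanceAs (DivisionRing ℂ)
  | quaternion => inferInstanceAs (DivisionRing ℍ[ℝ])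

noncomputable instance (k : DivKind) : StarRing k.carrier :=
  match k with
  | real => inferInstanceAs (StarRing ℝ)
  | complex => inferInstanceAs (StarRing ℂ)
  | quaternion => inferInstanceAs (StarRing ℍ[ℝ])

noncomputable instance (k : DivKind) : Algebra ℝ k.carrier :=
  match k with
  | real => inferInstanceAs (Algebra ℝ ℝ)
  | complex => inferInstanceAs (Algebra ℝ ℂ)
  | quaternion => inferInstanceAs (Algebra ℝ ℍ[ℝ])

instance (k : DivKind) : StarModule ℝ k.carrier :=
  match k with
  | real => inferInstanceAs (StarModule ℝ ℝ)
  | complex => inferInstanceAs (StarModule ℝ ℂ)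
  | quaternion => inferInstanceAs (StarModule ℝ ℍ[ℝ])

instance (k : DivKind) : FiniteDimensional ℝ k.carrier :=
  match k with
  | real => inferInstanceAs (FiniteDimensional ℝ ℝ)
  | complex => inferInstanceAs (FiniteDimensional ℝ ℂ)
  | quaternion => inferInstanceAs (FiniteDimensional ℝ ℍ[ℝ])

end DivKind

/-! ### Positive traces, spectra and decomposition into minimal projections -/

section Positive

variable {A : Type*} [Ring A] [StarRing A] [Algebra ℝ A]

/-- A faithful positive tracial functional on a real `*`-algebra. -/
structure IsPositiveTrace (τ : A →ₗ[ℝ] ℝ) : Prop where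
  map_mul_comm : ∀ a b, τ (a * b) = τ (b * a)
  nonneg : ∀ a, 0 ≤ τ (star a * a)
  eq_zero : ∀ a, τ (star a * a) = 0 → a = 0

/-- Every self-adjoint element has a finite real spectrum that decides which polynomials
annihilate it. -/
def HasRealSpectra (A : Type*) [Ring A] [StarRing A] [Algebra ℝ A] : Prop :=
  ∀ x : A, star x = x → ∃ S : Finset ℝ, ∀ P : Polynomial ℝ,
    Polynomial.aeval x P = 0 ↔ ∀ s ∈ S, P.eval s = 0

/-- The real part of the matrix trace works, since tr(M*M) is the sum of the squared moduli of the
entries of M. -/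
theorem IsMatrixStarAlgebra.exists_isPositiveTrace (hA : IsMatrixStarAlgebra A) :
    ∃ τ : A →ₗ[ℝ] ℝ, IsPositiveTrace τ := by
  obtain ⟨n, ρ, hρ⟩ := hA
  have key : ∀ M : Matrix (Fin n) (Fin n) ℂ,
      ((star M * M).trace).re = ∑ i, ∑ j, Complex.normSq (M j i) := by
    intro M
    simp [Matrix.trace, Matrix.mul_apply, Matrix.star_apply, Complex.normSq_apply]
  refine ⟨Complex.reLm ∘ₗ (Matrix.traceLinearMap (Fin n) ℝ ℂ) ∘ₗ ρ.toAlgHom.toLinearMap,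
    ?_, ?_, ?_⟩
  · intro a b
    simp [Matrix.trace_mul_comm (ρ a)]
  · intro a
    simp only [LinearMap.comp_apply, Matrix.traceLinearMap_apply, AlgHom.toLinearMap_apply,
      StarAlgHom.coe_toAlgHom, map_mul, map_star, Complex.reLm_coe, key]
    exact Finset.sum_nonneg fun _ _ => Finset.sum_nonneg fun _ _ => Complex.normSq_nonneg _
  · intro a
    simp only [LinearMap.comp_apply, Matrix.traceLinearMap_apply, AlgHom.toLinearMap_apply,
      StarAlgHom.coe_toAlgHom, map_mul, map_star, Complex.reLm_coe, key]
    intro h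
    apply hρ
    rw [map_zero]
    ext j i
    have h1 := (Finset.sum_eq_zero_iff_of_nonneg (fun _ _ =>
      Finset.sum_nonneg fun _ _ => Complex.normSq_nonneg _)).1 h i (Finset.mem_univ _)
    have h2 := (Finset.sum_eq_zero_iff_of_nonneg (fun _ _ =>
      Complex.normSq_nonneg _)).1 h1 j (Finset.mem_univ _)
    simpa using Complex.normSq_eq_zero.1 h2

/-- A Hermitian matrix is unitarily diagonalizable with real eigenvalues, and a polynomial kills a
diagonal matrix exactly when it vanishes at the diagonal entries. -/
theorem IsMatrixStarAlgebra.hasRealSpectra (hA : IsMatrixStarAlgebra A) :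
    HasRealSpectra A := by
  obtain ⟨n, ρ, hρ⟩ := hA
  intro x hx
  have hH : (ρ x).IsHermitian := by
    change star (ρ x) = ρ x
    rw [← map_star, hx]
  refine ⟨Finset.univ.image hH.eigenvalues, fun P => ?_⟩
  have h1 : Polynomial.aeval x P = 0 ↔ Polynomial.aeval (ρ x) P = 0 := by
    have : ρ (Polynomial.aeval x P) = Polynomial.aeval (ρ x) P :=
      (Polynomial.aeval_algHom_apply ρ.toAlgHom x P).symm
    rw [← this, map_eq_zero_iff ρ hρ]
  have h2 : Polynomial.aeval (Matrix.diagonal (RCLike.ofReal ∘ hH.eigenvalues) :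
      Matrix (Fin n) (Fin n) ℂ) P = Matrix.diagonal fun i => ((P.eval (hH.eigenvalues i) : ℝ) : ℂ) := by
    have := Polynomial.aeval_algHom_apply (Matrix.diagonalAlgHom (n := Fin n) (α := ℂ) ℝ)
      (fun i => (hH.eigenvalues i : ℂ)) P
    refine this.trans ?_
    change Matrix.diagonal _ = _
    congr 1
    funext i
    have h3 := Polynomial.aeval_algHom_apply (Pi.evalAlgHom ℝ (fun _ : Fin n => ℂ) i)
      (fun i => (hH.eigenvalues i : ℂ)) P
    have h4 := Polynomial.aeval_algebraMap_apply ℂ (hH.eigenvalues i) P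
    exact h3.symm.trans (h4.trans (by simp [Polynomial.aeval_def, Polynomial.eval₂_eq_eval_map]))
  rw [h1]
  set U := Unitary.conjStarAlgAut ℂ (Matrix (Fin n) (Fin n) ℂ) hH.eigenvectorUnitary
  have h5 := Polynomial.aeval_algHom_apply
    ((U.toAlgEquiv.restrictScalars ℝ).toAlgHom)
    (Matrix.diagonal (RCLike.ofReal ∘ hH.eigenvalues)) P
  have h6 : Polynomial.aeval (U (Matrix.diagonal (RCLike.ofReal ∘ hH.eigenvalues))) P =
    U (Matrix.diagonal fun i => ((P.eval (hH.eigenvalues i) : ℝ) : ℂ)) := by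
    rw [← h2]; exact h5
  rw [← hH.spectral_theorem] at h6
  rw [h6, map_eq_zero_iff U U.injective, Matrix.diagonal_eq_zero]
  simp [funext_iff]

/-- A minimal projection: the self-adjoint part of its corner consists of its real multiples. -/
structure IsMinimalProjection (p : A) : Prop where
  ne_zero : p ≠ 0
  mul_self : p * p = p
  star_eq : star p = p
  exists_smul : ∀ x, star x = x → p * x * p = x → ∃ t : ℝ, x = t • p

/-- The projection is a spectral projection of a self-adjoint x in the corner. If every such
projection were e itself, then x would have a single eigenvalue s on the corner, so x = s e and e
would be minimal. -/
theorem HasRealSpectra.exists_projection [StarModule ℝ A] (hS : HasRealSpectra A) {e : A}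
    (he0 : e ≠ 0) (he : e * e = e) (hes : star e = e) (hmin : ¬ IsMinimalProjection e) :
    ∃ q : A, q ≠ 0 ∧ q ≠ e ∧ q * q = q ∧ star q = q ∧ e * q = q ∧ q * e = q := by
  by_contra! hq
  refine hmin ⟨he0, he, hes, fun x hx hex => ?_⟩
  by_cases hx0 : x = 0
  · exact ⟨0, by simp [hx0]⟩
  have hxe : x * e = x := by rw [← hex, mul_assoc, he]
  have hex' : e * x = x := by rw [← hex, ← mul_assoc, ← mul_assoc, he]
  obtain ⟨S, hS⟩ := hS x hx
  have hs : ∃ s ∈ S, s ≠ 0 := by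
    by_contra! h
    apply hx0
    have := (hS Polynomial.X).2 (fun s hs => by simp [h s hs])
    simpa using this
  obtain ⟨s, hsS, hs0⟩ := hs
  -- The node 0 is added so that P is divisible by X. Then P(x) has no constant term and stays in
  -- the corner of e.
  obtain ⟨P, hP⟩ : ∃ P : Polynomial ℝ, ∀ r ∈ insert 0 S, P.eval r = if r = s then 1 else 0 :=
    ⟨Lagrange.interpolate (insert 0 S) id (fun r => if r = s then 1 else 0), fun r hr => by
      have := Lagrange.eval_interpolate_at_node (fun r => if r = s then (1 : ℝ) else 0)
        (v := id) Function.injective_id.injOn hr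
      simpa using this⟩
  have hP0 : P.eval 0 = 0 := by
    rw [hP 0 (Finset.mem_insert_self _ _), if_neg (Ne.symm hs0)]
  obtain ⟨R, hPdef⟩ : Polynomial.X ∣ P := by
    rw [Polynomial.X_dvd_iff, Polynomial.coeff_zero_eq_eval_zero, hP0]
  set q := Polynomial.aeval x P with hqdef
  have hqR : q = x * Polynomial.aeval x R := by rw [hqdef, hPdef]; simp
  have hqR' : q = Polynomial.aeval x R * x := by
    rw [hqdef, hPdef, mul_comm]; simp
  have hqq : q * q = q := by
    have := (hS (P * P - P)).2 (fun r hr => by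
      simp only [Polynomial.eval_sub, Polynomial.eval_mul, hP r (Finset.mem_insert_of_mem hr)]
      split_ifs <;> simp)
    rw [map_sub, map_mul, sub_eq_zero] at this
    exact this
  have hqs : star q = q := by
    have : ∀ Q : Polynomial ℝ, star (Polynomial.aeval x Q) = Polynomial.aeval x Q := by
      intro Q
      induction Q using Polynomial.induction_on' with
      | add f g hf hg => simp [hf, hg]
      | monomial n a =>
        simp [Polynomial.aeval_monomial, ← Algebra.smul_def, star_smul, star_pow, hx]
    exact this P
  have hq0 : q ≠ 0 := by
    intro h
    have := (hS P).1 h s hsS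
    rw [hP s (Finset.mem_insert_of_mem hsS), if_pos rfl] at this
    exact one_ne_zero this
  have hqe : q * e = q := by rw [hqR', mul_assoc, hxe]
  have heq : e * q = q := by rw [hqR, ← mul_assoc, hex']
  have hqe' : q = e := by
    by_contra hne
    exact hq q hq0 hne hqq hqs heq hqe
  refine ⟨s, ?_⟩
  -- (X - s)P vanishes on the spectrum, so xq = sq; with q = e this is x = s e.
  have := (hS (Polynomial.X * P - Polynomial.C s * P)).2 (fun r hr => by
      simp only [Polynomial.eval_sub, Polynomial.eval_mul, hP r (Finset.mem_insert_of_mem hr),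
        Polynomial.eval_X, Polynomial.eval_C]
      split_ifs with h <;> simp [h])
  rw [map_sub, map_mul, map_mul, sub_eq_zero, Polynomial.aeval_X, Polynomial.aeval_C,
    ← Algebra.smul_def, ← hqdef, hqe', hxe] at this
  exact this

/-- The corner `eAe`. -/
def corner (e : A) : Submodule ℝ A :=
  LinearMap.range (LinearMap.mulLeft ℝ e ∘ₗ LinearMap.mulRight ℝ e)

theorem finrank_corner_lt {A : Type*} [Ring A] [Algebra ℝ A] [FiniteDimensional ℝ A] {e q : A} (he : e * e = e) (heq : e * q = q) (hqe : q * e = q)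
    (hqq : q * q = q) (hne : q ≠ e) :
    Module.finrank ℝ (corner q) < Module.finrank ℝ (corner e) := by
  apply Submodule.finrank_lt_finrank_of_lt
  refine lt_of_le_of_ne ?_ ?_
  · rintro _ ⟨y, rfl⟩
    refine ⟨q * (y * q), ?_⟩
    change e * ((q * (y * q)) * e) = q * (y * q)
    rw [mul_assoc q, mul_assoc y, hqe, ← mul_assoc, heq]
  · intro h
    have : e ∈ corner e := ⟨e, by change e * (e * e) = e; rw [he, he]⟩
    rw [← h] at this
    obtain ⟨y, hy⟩ := this
    change q * (y * q) = e at hy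
    apply hne
    rw [← heq, ← hy, mul_assoc, mul_assoc, hqq]

/-- Induction on the dimension of eAe: a nonminimal e splits as q + (e - q), and both corners are
strictly smaller. -/
theorem HasRealSpectra.exists_minimal_decomposition [StarModule ℝ A] [FiniteDimensional ℝ A]
    (hS : HasRealSpectra A) (n : ℕ) :
    ∀ e : A, e * e = e → star e = e → Module.finrank ℝ (corner e) ≤ n →
    ∃ (ι : Type) (_ : Fintype ι) (p : ι → A), (∀ i, IsMinimalProjection (p i)) ∧
      (∀ i j, i ≠ j → p i * p j = 0) ∧ (∀ i, e * p i = p i ∧ p i * e = p i) ∧ ∑ i, p i = e := by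
  induction n with
  | zero =>
    intro e he hes hn
    have h0 : e = 0 := by
      have h1 : corner e = ⊥ := Submodule.finrank_eq_zero.1 (Nat.le_zero.1 hn)
      have h2 : e ∈ corner e := ⟨e, by change e * (e * e) = e; rw [he, he]⟩
      rw [h1] at h2
      simpa using h2
    exact ⟨Empty, inferInstance, Empty.elim, fun i => i.elim, fun i => i.elim, fun i => i.elim,
      by simp [h0]⟩
  | succ n ih =>
    intro e he hes hn
    by_cases he0 : e = 0
    · exact ⟨Empty, inferInstance, Empty.elim, fun i => i.elim, fun i => i.elim, fun i => i.elim,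
        by simp [he0]⟩
    by_cases hmin : IsMinimalProjection e
    · refine ⟨Unit, inferInstance, fun _ => e, fun _ => hmin, fun i j h => (h rfl).elim,
        fun _ => ⟨he, he⟩, by simp⟩
    obtain ⟨q, hq0, hqe, hqq, hqs, h1, h2⟩ := hS.exists_projection he0 he hes hmin
    have hrr : (e - q) * (e - q) = e - q := by
      simp only [mul_sub, sub_mul, he, h1, h2, hqq]; abel
    have hqr : q * (e - q) = 0 := by rw [mul_sub, h2, hqq, sub_self]
    have hrq : (e - q) * q = 0 := by rw [sub_mul, h1, hqq, sub_self]
    have her : e * (e - q) = e - q := by rw [mul_sub, he, h1]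
    have hre : (e - q) * e = e - q := by rw [sub_mul, he, h2]
    obtain ⟨ι, _, p, hp1, hp2, hp3, hp4⟩ := ih q hqq hqs
      (by have := finrank_corner_lt he h1 h2 hqq hqe; omega)
    obtain ⟨κ, _, r, hr1, hr2, hr3, hr4⟩ := ih (e - q) hrr (by rw [star_sub, hes, hqs])
      (by have := finrank_corner_lt he her hre hrr (by simpa using hq0); omega)
    refine ⟨ι ⊕ κ, inferInstance, Sum.elim p r, ?_, ?_, ?_, ?_⟩
    · rintro (i | i)
      exacts [hp1 i, hr1 i]
    · rintro (i | i) (j | j) hij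
      · exact hp2 i j (by simpa using hij)
      · change p i * r j = 0
        rw [← (hp3 i).2, ← (hr3 j).1, mul_assoc, ← mul_assoc q, hqr, zero_mul, mul_zero]
      · change r i * p j = 0
        rw [← (hr3 i).2, ← (hp3 j).1, mul_assoc, ← mul_assoc (e - q), hrq, zero_mul, mul_zero]
      · exact hr2 i j (by simpa using hij)
    · rintro (i | i)
      · change e * p i = p i ∧ p i * e = p i
        constructor
        · rw [← (hp3 i).1, ← mul_assoc, h1]
        · rw [← (hp3 i).2, mul_assoc, h2]
      · change e * r i = r i ∧ r i * e = r i
        constructor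
        · rw [← (hr3 i).1, ← mul_assoc, her]
        · rw [← (hr3 i).2, mul_assoc, hre]
    · simp [hp4, hr4]

end Positive

/-! ### Corners of minimal projections -/

section Corner

variable {A : Type*} [Ring A] [StarRing A] [Algebra ℝ A]
  {τ : A →ₗ[ℝ] ℝ} {p q : A}

theorem IsMinimalProjection.trace_pos (hp : IsMinimalProjection p) (hτ : IsPositiveTrace τ) :
    0 < τ p := by
  refine lt_of_le_of_ne ?_ fun h => hp.ne_zero (hτ.eq_zero p ?_)
  · simpa [hp.star_eq, hp.mul_self] using hτ.nonneg p
  · rw [hp.star_eq, hp.mul_self, ← h]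

/-- The element x*x is self-adjoint in the corner of q, hence a multiple of q; its trace is positive
because τ is faithful. -/
theorem IsMinimalProjection.star_mul_self_eq_smul (hq : IsMinimalProjection q)
    (hτ : IsPositiveTrace τ) {x : A} (hx : x * q = x) (hx0 : x ≠ 0) :
    ∃ t : ℝ, 0 < t ∧ star x * x = t • q := by
  obtain ⟨t, ht⟩ := hq.exists_smul (star x * x) (by simp) (by
    have : q * star x = star x := by rw [← hq.star_eq, ← star_mul, hx]
    rw [← mul_assoc, this, mul_assoc, hx])
  refine ⟨t, ?_, ht⟩
  have h1 := hq.trace_pos hτ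
  have h2 : τ (star x * x) = t * τ q := by rw [ht, map_smul, smul_eq_mul]
  have h3 : 0 < τ (star x * x) :=
    lt_of_le_of_ne (hτ.nonneg x) fun h => hx0 (hτ.eq_zero x h.symm)
  rw [h2] at h3
  exact pos_of_mul_pos_left h3 h1.le

/-- Two minimal projections `p`, `q` with `pAq ≠ 0` are joined by a partial isometry. -/
theorem IsMinimalProjection.exists_partialIsometry [StarModule ℝ A] (hp : IsMinimalProjection p)
    (hq : IsMinimalProjection q) (hτ : IsPositiveTrace τ) {a : A} (ha : p * a * q ≠ 0) :
    ∃ v : A, v * star v = p ∧ star v * v = q := by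
  obtain ⟨t, ht, hx⟩ := hq.star_mul_self_eq_smul hτ
    (by rw [mul_assoc, hq.mul_self] : p * a * q * q = p * a * q) ha
  set x := p * a * q with hxdef
  have hpx : p * x = x := by rw [hxdef, ← mul_assoc, ← mul_assoc, hp.mul_self]
  have hxq : x * q = x := by rw [hxdef, mul_assoc, hq.mul_self]
  set v := (Real.sqrt t)⁻¹ • x with hv
  have hvq : star v * v = q := by
    rw [hv, star_smul, smul_mul_smul_comm, hx, smul_smul, star_trivial, ← mul_inv,
      Real.mul_self_sqrt ht.le, inv_mul_cancel₀ ht.ne', one_smul]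
  have hpv : p * v = v := by rw [hv, mul_smul_comm, hpx]
  have hvq' : v * q = v := by rw [hv, smul_mul_assoc, hxq]
  have hvp : star v * p = star v := by
    conv_lhs => rw [← hp.star_eq, ← star_mul, hpv]
  obtain ⟨s, hs⟩ := hp.exists_smul (v * star v) (by simp) (by
    rw [← mul_assoc, hpv, mul_assoc, hvp])
  refine ⟨v, ?_, hvq⟩
  -- With vv* = s p, associativity of v v* v gives s v = v, so s = 1.
  have h1 : (s • p) * v = v := by rw [← hs, mul_assoc, hvq, hvq']
  rw [smul_mul_assoc, hpv] at h1
  have hv0 : v ≠ 0 := by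
    rintro h
    rw [h, mul_zero] at hvq
    exact hq.ne_zero hvq.symm
  have h2 : (s - 1) • v = 0 := by rw [sub_smul, h1, one_smul, sub_self]
  have h3 : s = 1 := sub_eq_zero.1 ((smul_eq_zero.1 h2).resolve_right hv0)
  rw [hs, h3, one_smul]

/-- The anticommutator of two skew elements is self-adjoint, hence scalar. It acts as an inner
product on the skew part of the corner, which gives the Clifford relations. -/
theorem IsMinimalProjection.exists_mul_add_mul (hp : IsMinimalProjection p) {x y : A} (hx : star x = -x)
    (hy : star y = -y) (hpx : p * x = x) (hxp : x * p = x) (hpy : p * y = y) (hyp : y * p = y) :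
    ∃ c : ℝ, x * y + y * x = c • p := by
  refine hp.exists_smul _ (by simp [hx, hy, add_comm]) ?_
  rw [mul_add, add_mul, ← mul_assoc, hpx, mul_assoc, hyp, ← mul_assoc, hpy, mul_assoc, hxp]

theorem IsMinimalProjection.exists_smul_mul_self (hp : IsMinimalProjection p) (hτ : IsPositiveTrace τ) {x : A}
    (hx : star x = -x) (hxp : x * p = x) (hx0 : x ≠ 0) :
    ∃ c : ℝ, (c • x) * (c • x) = -p := by
  obtain ⟨t, ht, h⟩ := hp.star_mul_self_eq_smul hτ hxp hx0
  refine ⟨(Real.sqrt t)⁻¹, ?_⟩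
  rw [hx, neg_mul, neg_eq_iff_eq_neg] at h
  rw [smul_mul_smul_comm, h, ← mul_inv, Real.mul_self_sqrt ht.le, smul_neg, smul_smul,
    inv_mul_cancel₀ ht.ne', one_smul]

variable [StarModule ℝ A]

/-- The embedding of `ℂ` given by a unit `p` and a square root of `-p`. -/
noncomputable def complexHom {i : A} (hpp : p * p = p) (hp : star p = p)
    (hpi : p * i = i) (hip : i * p = i) (hii : i * i = -p) (hi : star i = -i) :
    ℂ →⋆ₙₐ[ℝ] A where
  toFun z := z.re • p + z.im • i
  map_smul' c z := by
    simp only [Complex.real_smul, Complex.mul_re, Complex.mul_im, Complex.ofReal_re,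
      Complex.ofReal_im, MonoidHom.id_apply]
    module
  map_zero' := by simp
  map_add' z w := by simp only [Complex.add_re, Complex.add_im]; module
  map_mul' z w := by
    simp only [Complex.mul_re, Complex.mul_im, add_mul, mul_add, smul_mul_smul_comm, hpp, hpi, hip,
      hii]
    module
  map_star' z := by
    simp [star_smul, hp, hi]

/-- The embedding of `ℍ` given by a unit `p` and two anticommuting square roots of `-p`. -/
noncomputable def quaternionHom {i j : A} (hpp : p * p = p) (hp : star p = p)
    (hpi : p * i = i) (hip : i * p = i) (hii : i * i = -p) (hi : star i = -i)
    (hpj : p * j = j) (hjp : j * p = j) (hjj : j * j = -p) (hj : star j = -j)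
    (hji : j * i = -(i * j)) :
    ℍ[ℝ] →⋆ₙₐ[ℝ] A where
  toFun z := z.re • p + z.imI • i + z.imJ • j + z.imK • (i * j)
  map_smul' c z := by
    simp only [Quaternion.re_smul, Quaternion.imI_smul, Quaternion.imJ_smul, Quaternion.imK_smul,
      MonoidHom.id_apply, smul_eq_mul]
    module
  map_zero' := by simp
  map_add' z w := by
    simp only [Quaternion.re_add, Quaternion.imI_add, Quaternion.imJ_add, Quaternion.imK_add]
    module
  map_mul' z w := by
    have h1 : p * (i * j) = i * j := by rw [← mul_assoc, hpi]
    have h2 : i * j * p = i * j := by rw [mul_assoc, hjp]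
    have h3 : i * (i * j) = -j := by rw [← mul_assoc, hii, neg_mul, hpj]
    have h4 : i * j * i = j := by rw [mul_assoc, hji, mul_neg, h3, neg_neg]
    have h5 : j * (i * j) = i := by rw [← mul_assoc, hji, neg_mul, mul_assoc, hjj, mul_neg, hip,
      neg_neg]
    have h6 : i * j * j = -i := by rw [mul_assoc, hjj, mul_neg, hip]
    have h7 : i * j * (i * j) = -p := by rw [← mul_assoc, h4, hjj]
    simp only [Quaternion.re_mul, Quaternion.imI_mul, Quaternion.imJ_mul, Quaternion.imK_mul,
      add_mul, mul_add, smul_mul_smul_comm, hpp, hpi, hip, hii, hpj, hjp, hjj, hji, h1, h2, h3, h4,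
      h5, h6, h7]
    module
  map_star' z := by
    simp [star_smul, hp, hi, hj, hji]

namespace IsMinimalProjection

theorem exists_skew_decomposition (hp : IsMinimalProjection p) (a : A) :
    ∃ (t : ℝ) (x : A), star x = -x ∧ p * x = x ∧ x * p = x ∧ p * a * p = t • p + x := by
  have hs : star (p * a * p) = p * star a * p := by simp [hp.star_eq, mul_assoc]
  have hl : ∀ b, p * (p * b * p) = p * b * p := fun b => by
    rw [← mul_assoc, ← mul_assoc, hp.mul_self]
  have hr : ∀ b, p * b * p * p = p * b * p := fun b => by rw [mul_assoc, hp.mul_self]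
  obtain ⟨t, ht⟩ := hp.exists_smul ((2⁻¹ : ℝ) • (p * a * p + p * star a * p))
    (by rw [star_smul, star_add, hs, ← hs, star_star, star_trivial, add_comm])
    (by rw [mul_smul_comm, smul_mul_assoc, mul_add, add_mul, hl, hr, hl, hr])
  refine ⟨t, (2⁻¹ : ℝ) • (p * a * p - p * star a * p), ?_, ?_, ?_, ?_⟩
  · rw [star_smul, star_sub, hs, ← hs, star_star, star_trivial, ← smul_neg, neg_sub]
  · rw [mul_smul_comm, mul_sub, hl, hl]
  · rw [smul_mul_assoc, sub_mul, hr, hr]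
  · rw [← ht]; module

/-- The corner of a minimal projection is `ℝ`, `ℂ` or `ℍ`. -/
theorem exists_divKind (hp : IsMinimalProjection p) (hτ : IsPositiveTrace τ) :
    ∃ (k : DivKind) (φ : k.carrier →⋆ₙₐ[ℝ] A), φ 1 = p ∧ ∀ a, ∃ d, φ d = p * a * p := by
  -- The skew part of the corner is zero, a line ℝi, or larger; these cases give ℝ, ℂ and ℍ.
  by_cases h1 : ∀ x, star x = -x → p * x = x → x * p = x → x = 0
  · refine ⟨.real, ({
      toFun := fun t : ℝ => t • p
      map_smul' := fun c t => by simp [smul_smul]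
      map_zero' := zero_smul _ _
      map_add' := fun _ _ => add_smul _ _ _
      map_mul' := fun s t => by rw [smul_mul_smul_comm, hp.mul_self]
      map_star' := fun t => by rw [star_smul, hp.star_eq] } : ℝ →⋆ₙₐ[ℝ] A),
      one_smul ℝ p, fun a => ?_⟩
    obtain ⟨t, x, hx, hpx, hxp, h⟩ := hp.exists_skew_decomposition a
    exact ⟨t, by rw [h, h1 x hx hpx hxp, add_zero]; rfl⟩
  push Not at h1
  obtain ⟨x, hx, hpx, hxp, hx0⟩ := h1
  obtain ⟨c, hii⟩ := hp.exists_smul_mul_self hτ hx hxp hx0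
  have hi : star (c • x) = -(c • x) := by rw [star_smul, hx, star_trivial, smul_neg]
  have hpi : p * (c • x) = c • x := by rw [mul_smul_comm, hpx]
  have hip : (c • x) * p = c • x := by rw [smul_mul_assoc, hxp]
  generalize c • x = i at hii hi hpi hip
  by_cases h2 : ∀ y, star y = -y → p * y = y → y * p = y → ∃ t : ℝ, y = t • i
  · refine ⟨.complex, complexHom hp.mul_self hp.star_eq hpi hip hii hi, ?_, fun a => ?_⟩
    · change (1 : ℂ).re • p + (1 : ℂ).im • i = p
      simp
    · obtain ⟨t, y, hy, hpy, hyp, h⟩ := hp.exists_skew_decomposition a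
      obtain ⟨s, rfl⟩ := h2 y hy hpy hyp
      exact ⟨(⟨t, s⟩ : ℂ), h.symm⟩
  push Not at h2
  obtain ⟨y, hy, hpy, hyp, hyi⟩ := h2
  -- the part of a skew element orthogonal to a unit
  have orth : ∀ u, star u = -u → p * u = u → u * p = u → u * u = -p →
      ∀ z, star z = -z → p * z = z → z * p = z → ∃ d : ℝ,
        (z - d • u) * u = -(u * (z - d • u)) := by
    intro u hu hpu hup huu z hz hpz hzp
    obtain ⟨d, hd⟩ := hp.exists_mul_add_mul hz hu hpz hzp hpu hup
    -- From zu + uz = d p and u² = -p, the anticommutator of z - c u with u is (d + 2c) p.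
    refine ⟨-(d / 2), ?_⟩
    rw [← add_eq_zero_iff_eq_neg, sub_mul, mul_sub, smul_mul_assoc, mul_smul_comm, huu]
    linear_combination (norm := module) hd
  have hcl : ∀ {z u : A} (d : ℝ), star z = -z → p * z = z → z * p = z → star u = -u → p * u = u →
      u * p = u → star (z - d • u) = -(z - d • u) ∧ p * (z - d • u) = z - d • u ∧
        (z - d • u) * p = z - d • u := by
    intro z u d h1 h2 h3 h4 h5 h6
    refine ⟨?_, ?_, ?_⟩
    · rw [star_sub, star_smul, h1, h4, star_trivial]; module
    · rw [mul_sub, mul_smul_comm, h2, h5]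
    · rw [sub_mul, smul_mul_assoc, h3, h6]
  obtain ⟨d, hd⟩ := orth i hi hpi hip hii y hy hpy hyp
  obtain ⟨hw, hpw, hwp⟩ := hcl d hy hpy hyp hi hpi hip
  have hw0 : y - d • i ≠ 0 := fun h => hyi d (sub_eq_zero.1 h)
  obtain ⟨e, hjj⟩ := hp.exists_smul_mul_self hτ hw hwp hw0
  have hj : star (e • (y - d • i)) = -(e • (y - d • i)) := by
    rw [star_smul, hw, star_trivial, smul_neg]
  have hpj : p * (e • (y - d • i)) = e • (y - d • i) := by rw [mul_smul_comm, hpw]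
  have hjp : (e • (y - d • i)) * p = e • (y - d • i) := by rw [smul_mul_assoc, hwp]
  have hji : (e • (y - d • i)) * i = -(i * (e • (y - d • i))) := by
    rw [smul_mul_assoc, hd, mul_smul_comm, smul_neg]
  generalize e • (y - d • i) = j at hjj hj hpj hjp hji
  have hk : star (i * j) = -(i * j) := by rw [star_mul, hi, hj, neg_mul_neg, hji]
  have hpk : p * (i * j) = i * j := by rw [← mul_assoc, hpi]
  have hkp : i * j * p = i * j := by rw [mul_assoc, hjp]
  have hkk : i * j * (i * j) = -p := by
    rw [mul_assoc, ← mul_assoc j, hji, neg_mul, mul_assoc i j, hjj,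
      mul_neg, mul_neg, mul_neg, neg_neg, hip, hii]
  have hik : i * j * i = -(i * (i * j)) := by rw [mul_assoc, hji, mul_neg]
  have hjk : i * j * j = -(j * (i * j)) := by
    rw [← mul_assoc j, hji, neg_mul, neg_neg]
  refine ⟨.quaternion, quaternionHom hp.mul_self hp.star_eq hpi hip hii hi hpj hjp hjj hj hji, ?_,
    fun a => ?_⟩
  · change (1 : ℍ[ℝ]).re • p + (1 : ℍ[ℝ]).imI • i + (1 : ℍ[ℝ]).imJ • j +
      (1 : ℍ[ℝ]).imK • (i * j) = p
    simp
  obtain ⟨t, z, hz, hpz, hzp, h⟩ := hp.exists_skew_decomposition a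
  obtain ⟨d₁, h₁⟩ := orth i hi hpi hip hii z hz hpz hzp
  obtain ⟨hz₁, hpz₁, hzp₁⟩ := hcl d₁ hz hpz hzp hi hpi hip
  obtain ⟨d₂, h₂⟩ := orth j hj hpj hjp hjj _ hz₁ hpz₁ hzp₁
  obtain ⟨hz₂, hpz₂, hzp₂⟩ := hcl d₂ hz₁ hpz₁ hzp₁ hj hpj hjp
  obtain ⟨d₃, h₃⟩ := orth (i * j) hk hpk hkp hkk _ hz₂ hpz₂ hzp₂
  refine ⟨(⟨t, d₁, d₂, d₃⟩ : ℍ[ℝ]), ?_⟩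
  change t • p + d₁ • i + d₂ • j + d₃ • (i * j) = _
  -- Subtracting the j and ij components preserves anticommutation with i, as j and ij anticommute
  -- with i; likewise for j below.
  have h₁' : (z - d₁ • i - d₂ • j - d₃ • (i * j)) * i =
      -(i * (z - d₁ • i - d₂ • j - d₃ • (i * j))) := by
    rw [sub_mul, sub_mul _ (d₂ • j), h₁, smul_mul_assoc, smul_mul_assoc, hji, hik]
    simp only [mul_sub, mul_smul_comm]
    module
  have h₂' : (z - d₁ • i - d₂ • j - d₃ • (i * j)) * j =
      -(j * (z - d₁ • i - d₂ • j - d₃ • (i * j))) := by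
    rw [sub_mul, h₂, smul_mul_assoc, hjk]
    simp only [mul_sub, mul_smul_comm]
    module
  have hpl : p * (z - d₁ • i - d₂ • j - d₃ • (i * j)) = z - d₁ • i - d₂ • j - d₃ • (i * j) :=
    (hcl d₃ hz₂ hpz₂ hzp₂ hk hpk hkp).2.1
  set l := z - d₁ • i - d₂ • j - d₃ • (i * j) with hl
  -- The remainder l anticommutes with i and j, so it commutes with ij. It also anticommutes with ij
  -- by construction, so ij·l = 0, and l = 0 because (ij)² = -p.
  have h4 : l * (i * j) = i * j * l := by
    rw [← mul_assoc, h₁', neg_mul, mul_assoc, h₂', mul_neg, neg_neg, mul_assoc]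
  have h5 : i * j * l = 0 := by
    have h6 : (2 : ℝ) • (i * j * l) = 0 := by
      rw [two_smul]
      nth_rw 1 [← h4]
      rw [h₃, neg_add_cancel]
    exact (smul_eq_zero.1 h6).resolve_left two_ne_zero
  have h7 : l = 0 := by
    rw [← hpl, ← neg_neg p, ← hkk, neg_mul, mul_assoc, h5, mul_zero, neg_zero]
  rw [h]
  linear_combination (norm := module) hl - h7

end IsMinimalProjection

end Corner

/-! ### Matrix units and the Wedderburn decomposition -/

section Assembly

variable {A : Type*} [Ring A] [StarRing A] [Algebra ℝ A]

section MatrixHom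

variable {D : Type*} [Ring D] [StarRing D] [Algebra ℝ D] {n : Type*} [Fintype n] [DecidableEq n]

/-- A `*`-homomorphism `φ : D → A` and a family `v` of partial isometries with common initial
projection `φ 1` and orthogonal ranges extend `φ` to matrices over `D`. -/
noncomputable def matrixHom (φ : D →⋆ₙₐ[ℝ] A) (v : n → A)
    (h : ∀ i j, star (v i) * v j = if i = j then φ 1 else 0) : Matrix n n D →⋆ₙₐ[ℝ] A where
  toFun M := ∑ i, ∑ j, v i * φ (M i j) * star (v j)
  map_smul' c M := by
    simp [Finset.smul_sum]
  map_zero' := by simp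
  map_add' M M' := by
    simp [mul_add, add_mul, Finset.sum_add_distrib]
  map_mul' M M' := by
    have key : ∀ i j k l, v i * φ (M i j) * star (v j) * (v k * φ (M' k l) * star (v l)) =
        if j = k then v i * φ (M i j * M' k l) * star (v l) else 0 := by
      intro i j k l
      have h1 : v i * φ (M i j) * star (v j) * (v k * φ (M' k l) * star (v l)) =
        v i * φ (M i j) * (star (v j) * v k) * φ (M' k l) * star (v l) := by
        simp only [mul_assoc]
      rw [h1, h]
      split_ifs
      · rw [mul_assoc (v i), ← map_mul, mul_one, mul_assoc (v i), ← map_mul]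
      · simp
    have key' : ∀ i j, v i * φ (M i j) * star (v j) * (∑ k, ∑ l, v k * φ (M' k l) * star (v l)) =
        ∑ l, v i * φ (M i j * M' j l) * star (v l) := by
      intro i j
      simp only [Finset.mul_sum, key]
      rw [Finset.sum_comm]
      simp
    rw [Finset.sum_mul]
    refine Finset.sum_congr rfl fun i _ => ?_
    rw [Finset.sum_mul]
    simp only [key', Matrix.mul_apply, map_sum]
    rw [Finset.sum_comm]
    simp only [Finset.mul_sum, Finset.sum_mul]
  map_star' M := by
    simp only [star_sum, star_mul, star_star, ← map_star, Matrix.star_apply, mul_assoc]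
    exact Finset.sum_comm

theorem matrixHom_apply (φ : D →⋆ₙₐ[ℝ] A) (v : n → A)
    (h : ∀ i j, star (v i) * v j = if i = j then φ 1 else 0) (M : Matrix n n D) :
    matrixHom φ v h M = ∑ i, ∑ j, v i * φ (M i j) * star (v j) := rfl

theorem star_mul_matrixHom_mul (φ : D →⋆ₙₐ[ℝ] A) (v : n → A)
    (h : ∀ i j, star (v i) * v j = if i = j then φ 1 else 0) (M : Matrix n n D) (i j : n) :
    star (v i) * matrixHom φ v h M * v j = φ (M i j) := by
  rw [matrixHom_apply]
  simp only [Finset.mul_sum, Finset.sum_mul]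
  have key : ∀ k l, star (v i) * (v k * φ (M k l) * star (v l)) * v j =
      if i = k then if l = j then φ (M k l) else 0 else 0 := by
    intro k l
    have h1 : star (v i) * (v k * φ (M k l) * star (v l)) * v j =
      (star (v i) * v k) * φ (M k l) * (star (v l) * v j) := by
      simp only [mul_assoc]
    rw [h1, h, h]
    split_ifs <;> simp [← map_mul]
  simp [key]

end MatrixHom

variable {C : Type*} [Fintype C] {D : C → Type*} [∀ c, DivisionRing (D c)]
  [∀ c, StarRing (D c)] [∀ c, Algebra ℝ (D c)] {N : C → ℕ}

/-- The elements v_i φ(d) v_j* play the role of d times a matrix unit. Compressing by v_i* and v_j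
recovers an entry, which gives injectivity; surjectivity comes from the resolution of 1 by the
projections v_i v_i*. -/
theorem nonempty_starAlgEquiv_pi_matrix (φ : ∀ c, D c →⋆ₙₐ[ℝ] A) (v : ∀ c, Fin (N c) → A)
    (hφ : ∀ c, φ c 1 ≠ 0)
    (hv : ∀ c i j, star (v c i) * v c j = if i = j then φ c 1 else 0)
    (hne : ∀ c c', c ≠ c' → ∀ i j a, star (v c i) * a * v c' j = 0)
    (hsum : ∑ c, ∑ i, v c i * star (v c i) = 1)
    (hsurj : ∀ c i j a, ∃ d, φ c d = star (v c i) * a * v c j) :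
    Nonempty (A ≃⋆ₐ[ℝ] ∀ c, Matrix (Fin (N c)) (Fin (N c)) (D c)) := by
  classical
  have hz : ∀ c c', c ≠ c' → ∀ i j, star (v c i) * v c' j = 0 := fun c c' h i j => by
    simpa using hne c c' h i j 1
  have hmm : ∀ c c', c ≠ c' → ∀ M M', matrixHom (φ c) (v c) (hv c) M *
      matrixHom (φ c') (v c') (hv c') M' = 0 := by
    intro c c' h M M'
    have key : ∀ i j k l, v c i * φ c (M i j) * star (v c j) *
        (v c' k * φ c' (M' k l) * star (v c' l)) = 0 := by
      intro i j k l
      rw [mul_assoc, ← mul_assoc (star (v c j)), ← mul_assoc (star (v c j)), hz c c' h]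
      simp
    simp [matrixHom_apply, Finset.sum_mul, Finset.mul_sum, key]
  let Θ : (∀ c, Matrix (Fin (N c)) (Fin (N c)) (D c)) →⋆ₙₐ[ℝ] A :=
    { toFun := fun M => ∑ c, matrixHom (φ c) (v c) (hv c) (M c)
      map_smul' := fun r M => by simp [Finset.smul_sum]
      map_zero' := by simp
      map_add' := fun M M' => by simp [Finset.sum_add_distrib]
      map_mul' := fun M M' => by
        simp only [Finset.sum_mul, Finset.mul_sum, Pi.mul_apply, map_mul]
        refine Finset.sum_congr rfl fun c _ => ?_
        rw [Finset.sum_eq_single c]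
        · intro c' _ h
          exact hmm _ _ h _ _
        · simp
      map_star' := fun M => by simp [star_sum, map_star] }
  have hΘ : ∀ M, Θ M = ∑ c, matrixHom (φ c) (v c) (hv c) (M c) := fun _ => rfl
  have hcoef : ∀ M c i j, star (v c i) * Θ M * v c j = φ c (M c i j) := by
    intro M c i j
    rw [hΘ, Finset.mul_sum, Finset.sum_mul, Finset.sum_eq_single c]
    · exact star_mul_matrixHom_mul _ _ _ _ _ _
    · intro c' _ h
      rw [matrixHom_apply]
      simp only [Finset.mul_sum, Finset.sum_mul]
      refine Finset.sum_eq_zero fun k _ => Finset.sum_eq_zero fun l _ => ?_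
      rw [← mul_assoc, ← mul_assoc, hz c c' h.symm, zero_mul, zero_mul, zero_mul]
    · simp
  -- A nonzero d is invertible, so φ d = 0 would force φ 1 = 0.
  have hφinj : ∀ c d, φ c d = 0 → d = 0 := by
    intro c d hd
    by_contra h
    apply hφ c
    rw [← mul_inv_cancel₀ h, map_mul, hd, zero_mul]
  refine ⟨(StarAlgEquiv.ofBijective Θ ⟨?_, ?_⟩).symm⟩
  · rw [injective_iff_map_eq_zero]
    intro M hM
    funext c
    ext i j
    apply hφinj c
    rw [← hcoef, hM, mul_zero, zero_mul]
  · intro a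
    choose d hd using hsurj
    refine ⟨fun c => Matrix.of fun i j => d c i j a, ?_⟩
    -- The resolution of 1 is inserted on both sides of a; the terms joining different classes
    -- vanish by `hne`.
    have h1 : a = ∑ c, ∑ i, ∑ c', ∑ j, v c i * star (v c i) * a * (v c' j * star (v c' j)) := by
      simp only [← Finset.mul_sum, ← Finset.sum_mul, hsum, one_mul, mul_one]
    rw [hΘ]
    conv_rhs => rw [h1]
    refine Finset.sum_congr rfl fun c _ => ?_
    rw [matrixHom_apply]
    refine Finset.sum_congr rfl fun i _ => ?_
    rw [Finset.sum_eq_single c]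
    · refine Finset.sum_congr rfl fun j _ => ?_
      simp only [Matrix.of_apply, hd, mul_assoc]
    · intro c' _ h
      refine Finset.sum_eq_zero fun j _ => ?_
      have := hne c c' h.symm i j a
      rw [mul_assoc (v c i), ← mul_assoc, mul_assoc (v c i), this, mul_zero, zero_mul]
    · simp

theorem exists_starAlgEquiv_pi_matrix {A : Type*} [Ring A] [StarRing A] [Algebra ℝ A]
    [StarModule ℝ A] [FiniteDimensional ℝ A] (hS : HasRealSpectra A) {τ : A →ₗ[ℝ] ℝ}
    (hτ : IsPositiveTrace τ) :
    ∃ (C : Type) (_ : Fintype C) (k : C → DivKind) (N : C → ℕ), (∀ c, 0 < N c) ∧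
      Nonempty (A ≃⋆ₐ[ℝ] ∀ c, Matrix (Fin (N c)) (Fin (N c)) (k c).carrier) := by
  classical
  obtain ⟨ι, _, p, hp, hpo, -, hsum⟩ := hS.exists_minimal_decomposition _ 1 (one_mul 1)
    (star_one A) le_rfl
  -- Murray–von Neumann equivalence. Inequivalent minimal projections p, q satisfy pAq = 0, so each
  -- class gives one simple block.
  let r : Setoid ι :=
    { r := fun i j => ∃ v : A, v * star v = p i ∧ star v * v = p j
      iseqv := ⟨fun i => ⟨p i, by rw [(hp i).star_eq, (hp i).mul_self]; exact ⟨rfl, rfl⟩⟩,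
        fun {i j} ⟨v, h1, h2⟩ => ⟨star v, by rw [star_star]; exact ⟨h2, h1⟩⟩,
        fun {i j l} ⟨v, h1, h2⟩ ⟨w, h3, h4⟩ => ⟨v * w, by
          have e1 : v * w * star (v * w) = v * (w * star w) * star v := by
            simp only [star_mul, mul_assoc]
          have e2 : star (v * w) * (v * w) = star w * (star v * v) * w := by
            simp only [star_mul, mul_assoc]
          have e3 : v * (star v * v) * star v = (v * star v) * (v * star v) := by
            simp only [mul_assoc]
          have e4 : star w * (w * star w) * w = (star w * w) * (star w * w) := by
            simp only [mul_assoc]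
          constructor
          · rw [e1, h3, ← h2, e3, h1, (hp i).mul_self]
          · rw [e2, h2, ← h3, e4, h4, (hp l).mul_self]⟩⟩ }
  have hzero : ∀ i j, ¬ r i j → ∀ a, p i * a * p j = 0 := by
    intro i j hij a
    by_contra h
    exact hij ((hp i).exists_partialIsometry (hp j) hτ h)
  let C := Quotient r
  have hrep : ∀ c : C, ∀ i : {i // (Quotient.mk r i) = c},
      ∃ v : A, v * star v = p i ∧ star v * v = p c.out := by
    rintro c ⟨i, rfl⟩
    exact Setoid.symm (Quotient.mk_out (s := r) i)
  choose w hw1 hw2 using hrep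
  let N : C → ℕ := fun c => Fintype.card {i // (Quotient.mk r i) = c}
  let e : ∀ c : C, Fin (N c) ≃ {i // (Quotient.mk r i) = c} := fun c => (Fintype.equivFin _).symm
  have hk := fun c : C => (hp c.out).exists_divKind hτ
  choose k φ hφ1 hφ using hk
  have hpw : ∀ c (i : {i // (Quotient.mk r i) = c}), p (i : ι) * w c i = w c i := by
    intro c i
    refine sub_eq_zero.1 (hτ.eq_zero _ ?_)
    -- Faithfulness of τ reduces p w = w to the vanishing of (pw - w)*(pw - w).
    have : star (p (i : ι) * w c i - w c i) * (p (i : ι) * w c i - w c i) = 0 := by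
      rw [star_sub, star_mul, (hp i).star_eq, ← hw1 c i]
      have e1 : star (w c i) * (w c i * star (w c i)) = p c.out * star (w c i) := by
        rw [← mul_assoc, hw2]
      have e2 : w c i * star (w c i) * w c i = w c i * p c.out := by
        rw [mul_assoc, hw2]
      have e3 : star (w c i) * (w c i * p c.out) = p c.out := by
        rw [← mul_assoc, hw2, (hp _).mul_self]
      simp only [e1, e2, sub_mul, mul_sub, mul_assoc, e3, hw2, (hp _).mul_self]
      abel
    rw [this, map_zero]
  have hwp : ∀ c (i : {i // (Quotient.mk r i) = c}), star (w c i) * p (i : ι) = star (w c i) := by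
    intro c i
    conv_lhs => rw [← (hp i).star_eq, ← star_mul, hpw]
  refine ⟨C, inferInstance, k, N, ?_, ?_⟩
  · intro c
    exact Fintype.card_pos_iff.2 ⟨⟨c.out, Quotient.out_eq c⟩⟩
  refine nonempty_starAlgEquiv_pi_matrix φ (fun c i => w c (e c i)) ?_ ?_ ?_ ?_ ?_
  · intro c
    rw [hφ1]
    exact (hp _).ne_zero
  · intro c i j
    split_ifs with h
    · rw [h, hw2, hφ1]
    · rw [← hwp, ← hpw c (e c j), mul_assoc, ← mul_assoc (p _) (p _), hpo, zero_mul, mul_zero]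
      intro h'
      exact h ((e c).injective (Subtype.ext h'))
  · intro c c' hcc i j a
    have h1 : p (e c i : ι) * a * p (e c' j : ι) = 0 := by
      apply hzero
      intro h
      apply hcc
      rw [← (e c i).2, ← (e c' j).2]
      exact Quotient.sound h
    rw [← hwp, ← hpw c' (e c' j)]
    have : star (w c (e c i)) * p (e c i : ι) * a * (p (e c' j : ι) * w c' (e c' j)) =
        star (w c (e c i)) * (p (e c i : ι) * a * p (e c' j : ι)) * w c' (e c' j) := by
      simp only [mul_assoc]
    rw [this, h1, mul_zero, zero_mul]
  · rw [← hsum]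
    have h1 : ∀ c, ∑ i, w c (e c i) * star (w c (e c i)) =
        ∑ i : {i // (Quotient.mk r i) = c}, p (i : ι) := by
      intro c
      rw [← Equiv.sum_comp (e c)]
      simp only [hw1]
    simp only [h1]
    exact Fintype.sum_fiberwise (Quotient.mk r) p
  · intro c i j a
    obtain ⟨d, hd⟩ := hφ c (star (w c (e c i)) * a * w c (e c j))
    refine ⟨d, ?_⟩
    have h1 : ∀ i, w c i * p c.out = w c i := by
      intro i
      rw [← hw2 c i, ← mul_assoc, hw1, hpw]
    have h2 : ∀ i, p c.out * star (w c i) = star (w c i) := by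
      intro i
      conv_lhs => rw [← (hp c.out).star_eq, ← star_mul, h1]
    rw [hd, ← mul_assoc, ← mul_assoc, h2, mul_assoc _ (w c _), h1]

end Assembly

/-! ### Dimension counts for subspaces -/

section LinearAlgebra

theorem finrank_submodule_eq {V W : Type*} [AddCommGroup V] [Module ℝ V] [AddCommGroup W]
    [Module ℝ W] (e : V ≃ₗ[ℝ] W) {p : Submodule ℝ V} {q : Submodule ℝ W}
    (h : ∀ x, x ∈ p ↔ e x ∈ q) : Module.finrank ℝ p = Module.finrank ℝ q := by
  have : p.map (e : V →ₗ[ℝ] W) = q := by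
    ext y
    constructor
    · rintro ⟨x, hx, rfl⟩
      exact (h x).1 hx
    · intro hy
      exact ⟨e.symm y, (h _).2 (by simpa using hy), by simp⟩
  rw [← this]
  exact (e.submoduleMap p).finrank_eq

theorem finrank_submodule_pi {C : Type*} [Fintype C] {V : C → Type*} [∀ c, AddCommGroup (V c)]
    [∀ c, Module ℝ (V c)] [∀ c, FiniteDimensional ℝ (V c)] {p : Submodule ℝ (∀ c, V c)}
    {q : ∀ c, Submodule ℝ (V c)} (h : ∀ x, x ∈ p ↔ ∀ c, x c ∈ q c) :
    Module.finrank ℝ p = ∑ c, Module.finrank ℝ (q c) := by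
  let e : p ≃ₗ[ℝ] ∀ c, q c :=
    { toFun := fun x c => ⟨x.1 c, (h _).1 x.2 c⟩
      invFun := fun y => ⟨fun c => y c, (h _).2 fun c => (y c).2⟩
      map_add' := fun _ _ => rfl
      map_smul' := fun _ _ => rfl
      left_inv := fun _ => rfl
      right_inv := fun _ => rfl }
  rw [e.finrank_eq, Module.finrank_pi_fintype]

theorem finrank_eq_finrank_inf_ker_add_one {V : Type*} [AddCommGroup V] [Module ℝ V]
    [FiniteDimensional ℝ V] (W : Submodule ℝ V) (F : V →ₗ[ℝ] ℝ) (h : ∃ x ∈ W, F x ≠ 0) :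
    Module.finrank ℝ W = Module.finrank ℝ (W ⊓ LinearMap.ker F : Submodule ℝ V) + 1 := by
  have h1 := LinearMap.finrank_range_add_finrank_ker (F.domRestrict W)
  have h2 : LinearMap.range (F.domRestrict W) = ⊤ := by
    obtain ⟨x, hx, hF⟩ := h
    refine LinearMap.range_eq_top.2 (LinearMap.surjective fun h0 => hF ?_)
    simpa using LinearMap.congr_fun h0 ⟨x, hx⟩
  have h3 : (LinearMap.ker (F.domRestrict W)).map W.subtype = W ⊓ LinearMap.ker F := by
    ext x
    simp only [Submodule.mem_map, LinearMap.mem_ker, Submodule.mem_inf]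
    constructor
    · rintro ⟨y, hy, rfl⟩
      exact ⟨y.2, hy⟩
    · rintro ⟨hx, hF⟩
      exact ⟨⟨x, hx⟩, hF, rfl⟩
  have h4 := (Submodule.equivMapOfInjective W.subtype W.subtype_injective
    (LinearMap.ker (F.domRestrict W))).finrank_eq
  rw [h2, finrank_top, Module.finrank_self] at h1
  rw [← h3]
  omega

end LinearAlgebra

/-! ### Two invariants: the dimensions of u(A) and of its centre -/

section Invariants

/-- The skew-adjoint elements of `A` that commute with every skew-adjoint element. -/
def skewCenter (A : Type*) [Ring A] [StarRing A] [Algebra ℝ A] [StarModule ℝ A] :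
    Submodule ℝ A where
  carrier := {X | star X = -X ∧ ∀ Y, star Y = -Y → X * Y = Y * X}
  add_mem' := by
    rintro X X' ⟨hX, h⟩ ⟨hX', h'⟩
    refine ⟨by rw [star_add, hX, hX', neg_add], fun Y hY => ?_⟩
    rw [add_mul, mul_add, h Y hY, h' Y hY]
  zero_mem' := ⟨by simp, by simp⟩
  smul_mem' := by
    rintro c X ⟨hX, h⟩
    refine ⟨by rw [star_smul, hX, star_trivial, smul_neg], fun Y hY => ?_⟩
    rw [smul_mul_assoc, mul_smul_comm, h Y hY]

variable {A B : Type*} [Ring A] [StarRing A] [Algebra ℝ A] [StarModule ℝ A]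
  [Ring B] [StarRing B] [Algebra ℝ B] [StarModule ℝ B]

theorem mem_unitaryLie {X : A} : X ∈ unitaryLie A ↔ star X = -X := Iff.rfl

theorem mem_skewCenter {X : A} :
    X ∈ skewCenter A ↔ star X = -X ∧ ∀ Y, star Y = -Y → X * Y = Y * X := Iff.rfl

theorem StarAlgEquiv.star_eq_neg_iff {A B : Type*} [Ring A] [StarRing A] [Algebra ℝ A]
    [Ring B] [StarRing B] [Algebra ℝ B] (e : A ≃⋆ₐ[ℝ] B) (X : A) :
    star (e X) = -e X ↔ star X = -X := by
  rw [← map_star, ← map_neg, (EquivLike.injective e).eq_iff]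

theorem StarAlgEquiv.finrank_unitaryLie_eq (e : A ≃⋆ₐ[ℝ] B) :
    Module.finrank ℝ (unitaryLie A).toSubmodule = Module.finrank ℝ (unitaryLie B).toSubmodule :=
  finrank_submodule_eq e.toAlgEquiv.toLinearEquiv fun X => (e.star_eq_neg_iff X).symm

theorem StarAlgEquiv.finrank_skewCenter_eq (e : A ≃⋆ₐ[ℝ] B) :
    Module.finrank ℝ (skewCenter A) = Module.finrank ℝ (skewCenter B) := by
  refine finrank_submodule_eq e.toAlgEquiv.toLinearEquiv fun X => ?_
  change _ ↔ e X ∈ skewCenter B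
  rw [mem_skewCenter, mem_skewCenter, e.star_eq_neg_iff]
  refine and_congr_right fun _ => ⟨fun h Y hY => ?_, fun h Y hY => ?_⟩
  · obtain ⟨Y, rfl⟩ := EquivLike.surjective e Y
    rw [← map_mul, h Y ((e.star_eq_neg_iff Y).1 hY), map_mul]
  · apply EquivLike.injective e
    rw [map_mul, map_mul, h _ ((e.star_eq_neg_iff Y).2 hY)]

section Pi

variable {C : Type*} [Fintype C] {V : C → Type*} [∀ c, Ring (V c)] [∀ c, StarRing (V c)]
  [∀ c, Algebra ℝ (V c)] [∀ c, StarModule ℝ (V c)] [∀ c, FiniteDimensional ℝ (V c)]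

theorem finrank_unitaryLie_pi : Module.finrank ℝ (unitaryLie (∀ c, V c)).toSubmodule =
    ∑ c, Module.finrank ℝ (unitaryLie (V c)).toSubmodule :=
  finrank_submodule_pi fun X => by
    change star X = -X ↔ ∀ c, star (X c) = -X c
    rw [funext_iff]
    rfl

theorem finrank_skewCenter_pi : Module.finrank ℝ (skewCenter (∀ c, V c)) =
    ∑ c, Module.finrank ℝ (skewCenter (V c)) := by
  classical
  refine finrank_submodule_pi fun X => ?_
  simp only [mem_skewCenter]
  constructor
  · rintro ⟨h1, h2⟩ c
    refine ⟨congrFun h1 c, fun Y hY => ?_⟩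
    have := congrFun (h2 (Pi.single c Y) (by
      funext d
      by_cases h : d = c
      · subst h; simpa using hY
      · simp [h])) c
    simpa using this
  · intro h
    exact ⟨funext fun c => (h c).1, fun Y hY => funext fun c => (h c).2 _ (congrFun hY c)⟩

end Pi

section Matrix

variable {D : Type*} [Ring D] [StarRing D] [Algebra ℝ D] [StarModule ℝ D]

/-- A skew-Hermitian matrix amounts to N skew diagonal entries and arbitrary entries above the
diagonal. -/
theorem finrank_unitaryLie_matrix [FiniteDimensional ℝ D] (N : ℕ) :
    Module.finrank ℝ (unitaryLie (Matrix (Fin N) (Fin N) D)).toSubmodule =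
      N * Module.finrank ℝ (unitaryLie D).toSubmodule + N * (N - 1) / 2 * Module.finrank ℝ D := by
  have hmem : ∀ M : Matrix (Fin N) (Fin N) D,
      M ∈ (unitaryLie (Matrix (Fin N) (Fin N) D)).toSubmodule ↔ ∀ i j, star (M j i) = -M i j :=
    fun M => by
      change star M = -M ↔ _
      rw [← Matrix.ext_iff]
      rfl
  let f : (unitaryLie (Matrix (Fin N) (Fin N) D)).toSubmodule →ₗ[ℝ]
      (Fin N → (unitaryLie D).toSubmodule) × ((Σ j : Fin N, {i : Fin N // i < j}) → D) :=
    { toFun := fun M => (fun i => ⟨M.1 i i, (hmem M.1).1 M.2 i i⟩, fun p => M.1 p.2 p.1)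
      map_add' := fun _ _ => rfl
      map_smul' := fun _ _ => rfl }
  have hf : Function.Bijective f := by
    constructor
    · rw [injective_iff_map_eq_zero]
      rintro ⟨M, hM⟩ h
      have h1 : ∀ i, M i i = 0 := fun i => congrArg Subtype.val (congrFun (congrArg Prod.fst h) i)
      have h2 : ∀ i j, i < j → M i j = 0 := fun i j hij =>
        congrFun (congrArg Prod.snd h) ⟨j, i, hij⟩
      refine Subtype.ext (Matrix.ext fun i j => ?_)
      change M i j = 0
      rcases lt_trichotomy i j with hij | rfl | hij
      · exact h2 i j hij
      · exact h1 i
      · have := (hmem M).1 hM i j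
        rw [h2 j i hij, star_zero] at this
        exact neg_eq_zero.1 this.symm
    · rintro ⟨a, b⟩
      let M : Matrix (Fin N) (Fin N) D := Matrix.of fun i j =>
        if h : i < j then b ⟨j, i, h⟩ else if h' : j < i then -star (b ⟨i, j, h'⟩) else a i
      have hM : M ∈ (unitaryLie (Matrix (Fin N) (Fin N) D)).toSubmodule := by
        rw [hmem]
        intro i j
        rcases lt_trichotomy i j with hij | rfl | hij
        · simp [M, hij, hij.not_gt]
        · simpa [M] using mem_unitaryLie.1 (a i).2
        · simp [M, hij, hij.not_gt]
      refine ⟨⟨M, hM⟩, Prod.ext (funext fun i => Subtype.ext ?_) (funext fun p => ?_)⟩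
      · change M i i = a i
        simp [M]
      · obtain ⟨j, i, h⟩ := p
        change M i j = _
        simp [M, h]
  rw [(LinearEquiv.ofBijective f hf).finrank_eq, Module.finrank_prod, Module.finrank_pi_fintype,
    Module.finrank_pi_fintype]
  simp only [Finset.sum_const, Finset.card_univ, Fintype.card_fin, smul_eq_mul, Fintype.card_sigma,
    Fintype.card_subtype, Finset.filter_gt_eq_Iio]
  congr 2
  simp only [Fin.card_Iio]
  rw [Fin.sum_univ_eq_sum_range (fun i => i), Finset.sum_range_id]

/-- Compare the (i, j) entries after commuting with E_ij - E_ji. -/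
theorem skewCenter_matrix_diag {N : ℕ} {X : Matrix (Fin N) (Fin N) D}
    (hX : X ∈ skewCenter (Matrix (Fin N) (Fin N) D)) (i j : Fin N) : X i i = X j j := by
  by_cases hij : i = j
  · rw [hij]
  have := hX.2 (Matrix.single i j 1 - Matrix.single j i 1) (by
    simp [Matrix.star_eq_conjTranspose, Matrix.conjTranspose_single])
  have := congrFun (congrFun this i) j
  simpa [Matrix.mul_apply, Matrix.single_apply, hij, Ne.symm hij, sub_mul, mul_sub] using this

theorem skewCenter_matrix_diag_mem {N : ℕ} {X : Matrix (Fin N) (Fin N) D}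
    (hX : X ∈ skewCenter (Matrix (Fin N) (Fin N) D)) (i : Fin N) : X i i ∈ skewCenter D := by
  refine ⟨congrFun (congrFun hX.1 i) i, fun u hu => ?_⟩
  have := hX.2 (Matrix.single i i u) (by
    rw [Matrix.star_eq_conjTranspose, Matrix.conjTranspose_single, hu, ← Matrix.single_neg])
  have := congrFun (congrFun this i) i
  simpa [Matrix.mul_apply, Matrix.single_apply] using this

/-- Commuting with u E_ii gives u X_ij = 0. This serves ℂ and ℍ; over ℝ no nonzero skew scalar u is
available. -/
theorem skewCenter_matrix_offDiag {N : ℕ} {X : Matrix (Fin N) (Fin N) D}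
    (hX : X ∈ skewCenter (Matrix (Fin N) (Fin N) D)) {u : D} (hu : star u = -u)
    (hu' : ∀ x, u * x = 0 → x = 0) {i j : Fin N} (hij : i ≠ j) : X i j = 0 := by
  have := hX.2 (Matrix.single i i u) (by
    rw [Matrix.star_eq_conjTranspose, Matrix.conjTranspose_single, hu, ← Matrix.single_neg])
  have := congrFun (congrFun this i) j
  apply hu'
  simpa [Matrix.mul_apply, Matrix.single_apply, hij, eq_comm] using this

/-- A third index l replaces the skew scalar: the (i, l) entry of the commutator with E_jl - E_lj
isolates X_ij. With N = 2 no such l exists, and so(2) is indeed abelian. -/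
theorem skewCenter_matrix_offDiag_of_two_lt {N : ℕ} (hN : 2 < N) {X : Matrix (Fin N) (Fin N) D}
    (hX : X ∈ skewCenter (Matrix (Fin N) (Fin N) D)) {i j : Fin N} (hij : i ≠ j) : X i j = 0 := by
  obtain ⟨l, hl⟩ : ∃ l, l ∉ ({i, j} : Finset (Fin N)) := by
    by_contra! h
    have h1 : Finset.univ ⊆ ({i, j} : Finset (Fin N)) := fun l _ => h l
    have h2 := (Finset.card_le_card h1).trans Finset.card_le_two
    simp at h2
    omega
  simp only [Finset.mem_insert, Finset.mem_singleton, not_or] at hl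
  have := hX.2 (Matrix.single j l 1 - Matrix.single l j 1) (by
    simp [Matrix.star_eq_conjTranspose, Matrix.conjTranspose_single])
  have := congrFun (congrFun this i) l
  simpa [Matrix.mul_apply, Matrix.single_apply, hij, Ne.symm hij, hl.1, hl.2, Ne.symm hl.1,
    Ne.symm hl.2, sub_mul, mul_sub] using this

end Matrix

end Invariants

/-! ### The invariants of M_N(ℝ), M_N(ℂ) and M_N(ℍ) -/

section Blocks

theorem skewCenter_le {A : Type*} [Ring A] [StarRing A] [Algebra ℝ A] [StarModule ℝ A] :
    skewCenter A ≤ (unitaryLie A).toSubmodule := fun _ h => h.1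

theorem unitaryLie_real : (unitaryLie ℝ).toSubmodule = ⊥ := by
  rw [Submodule.eq_bot_iff]
  intro x hx
  have h : star x = -x := hx
  rw [star_trivial] at h
  linarith

theorem mem_unitaryLie_complex {z : ℂ} : z ∈ unitaryLie ℂ ↔ z.re = 0 := by
  rw [mem_unitaryLie, Complex.ext_iff]
  simp only [RCLike.star_def, Complex.conj_re, Complex.neg_re, Complex.conj_im, Complex.neg_im,
    and_true]
  constructor <;> intro h <;> linarith

theorem mem_unitaryLie_quaternion {z : ℍ[ℝ]} :
    z ∈ unitaryLie ℍ[ℝ] ↔ z.re = 0 := by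
  rw [mem_unitaryLie, Quaternion.ext_iff]
  simp only [Quaternion.re_star, Quaternion.re_neg, Quaternion.imI_star, Quaternion.imI_neg,
    Quaternion.imJ_star, Quaternion.imJ_neg, Quaternion.imK_star, Quaternion.imK_neg, and_true]
  constructor <;> intro h <;> linarith

theorem finrank_unitaryLie_complex : Module.finrank ℝ (unitaryLie ℂ).toSubmodule = 1 := by
  have h := finrank_eq_finrank_inf_ker_add_one (⊤ : Submodule ℝ ℂ) Complex.reLm ⟨1, trivial, by simp⟩
  have h1 : (⊤ ⊓ LinearMap.ker Complex.reLm : Submodule ℝ ℂ) = (unitaryLie ℂ).toSubmodule := by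
    ext z
    rw [top_inf_eq, LinearMap.mem_ker]
    exact mem_unitaryLie_complex.symm
  rw [finrank_top, Complex.finrank_real_complex, h1] at h
  omega

theorem finrank_unitaryLie_quaternion :
    Module.finrank ℝ (unitaryLie ℍ[ℝ]).toSubmodule = 3 := by
  let F : ℍ[ℝ] →ₗ[ℝ] ℝ := { toFun := fun z => z.re, map_add' := by simp, map_smul' := by simp }
  have h := finrank_eq_finrank_inf_ker_add_one (⊤ : Submodule ℝ ℍ[ℝ]) F ⟨1, trivial, one_ne_zero (α := ℝ)⟩
  have h1 : (⊤ ⊓ LinearMap.ker F : Submodule ℝ ℍ[ℝ]) = (unitaryLie ℍ[ℝ]).toSubmodule := by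
    ext z
    rw [top_inf_eq, LinearMap.mem_ker]
    exact mem_unitaryLie_quaternion.symm
  rw [finrank_top, Quaternion.finrank_eq_four, h1] at h
  omega

theorem skewCenter_quaternion : skewCenter ℍ[ℝ] = ⊥ := by
  rw [Submodule.eq_bot_iff]
  rintro z ⟨hz, h⟩
  have h0 : z.re = 0 := mem_unitaryLie_quaternion.1 hz
  obtain ⟨i, hi⟩ : ∃ i : ℍ[ℝ], i.re = 0 ∧ i.imI = 1 ∧ i.imJ = 0 ∧ i.imK = 0 :=
    ⟨⟨0, 1, 0, 0⟩, rfl, rfl, rfl, rfl⟩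
  obtain ⟨j, hj⟩ : ∃ j : ℍ[ℝ], j.re = 0 ∧ j.imI = 0 ∧ j.imJ = 1 ∧ j.imK = 0 :=
    ⟨⟨0, 0, 1, 0⟩, rfl, rfl, rfl, rfl⟩
  have h1 := Quaternion.ext_iff.1 (h i (mem_unitaryLie_quaternion.2 hi.1))
  have h2 := Quaternion.ext_iff.1 (h j (mem_unitaryLie_quaternion.2 hj.1))
  simp only [Quaternion.re_mul, Quaternion.imI_mul, Quaternion.imJ_mul, Quaternion.imK_mul, hi,
    hj] at h1 h2
  obtain ⟨-, -, h3, h4⟩ := h1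
  obtain ⟨-, -, -, h5⟩ := h2
  refine Quaternion.ext_iff.2 ⟨h0, ?_, ?_, ?_⟩
  · rw [Quaternion.imI_zero]; linarith
  · rw [Quaternion.imJ_zero]; linarith
  · rw [Quaternion.imK_zero]; linarith

theorem skewCenter_matrix_real {N : ℕ} (hN : N ≠ 2) :
    skewCenter (Matrix (Fin N) (Fin N) ℝ) = ⊥ := by
  rw [Submodule.eq_bot_iff]
  intro X hX
  have hs : ∀ i j, X j i = -X i j := fun i j => congrFun (congrFun hX.1 i) j
  ext i j
  by_cases hij : i = j
  · subst hij
    have := hs i i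
    simp only [Matrix.zero_apply]
    linarith
  -- Two distinct indices force N ≥ 2, hence N > 2.
  · refine skewCenter_matrix_offDiag_of_two_lt ?_ hX hij
    have h1 := i.2
    have h2 := j.2
    have h3 : (i : ℕ) ≠ j := fun h => hij (Fin.ext h)
    omega

theorem finrank_skewCenter_matrix_real_two :
    Module.finrank ℝ (skewCenter (Matrix (Fin 2) (Fin 2) ℝ)) = 1 := by
  have : skewCenter (Matrix (Fin 2) (Fin 2) ℝ) =
      (unitaryLie (Matrix (Fin 2) (Fin 2) ℝ)).toSubmodule := by
    refine le_antisymm skewCenter_le fun X hX => ⟨hX, fun Y hY => ?_⟩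
    have h1 : ∀ i j, X j i = -X i j := fun i j => congrFun (congrFun hX i) j
    have h2 : ∀ i j, Y j i = -Y i j := fun i j => congrFun (congrFun hY i) j
    have h3 : ∀ i, X i i = 0 := fun i => by linarith [h1 i i]
    have h4 : ∀ i, Y i i = 0 := fun i => by linarith [h2 i i]
    ext i j
    fin_cases i <;> fin_cases j <;>
      simp [Matrix.mul_apply, Fin.sum_univ_two, h3, h4, h1 0 1, h2 0 1] <;> ring
  rw [this, finrank_unitaryLie_matrix, unitaryLie_real]
  simp

theorem skewCenter_matrix_complex {N : ℕ} {X : Matrix (Fin N) (Fin N) ℂ}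
    (hX : X ∈ skewCenter (Matrix (Fin N) (Fin N) ℂ)) (i : Fin N) :
    X = (X i i).im • (Complex.I • (1 : Matrix (Fin N) (Fin N) ℂ)) := by
  have h0 : (X i i).re = 0 :=
    mem_unitaryLie_complex.1 (skewCenter_le (skewCenter_matrix_diag_mem hX i))
  ext j l
  by_cases hjl : j = l
  · subst hjl
    rw [skewCenter_matrix_diag hX j i]
    apply Complex.ext <;> simp [h0]
  · rw [skewCenter_matrix_offDiag hX (u := Complex.I) (by simp) (by simp) hjl]
    simp [hjl]

theorem finrank_skewCenter_matrix_complex {N : ℕ} (hN : 0 < N) :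
    Module.finrank ℝ (skewCenter (Matrix (Fin N) (Fin N) ℂ)) = 1 := by
  have : skewCenter (Matrix (Fin N) (Fin N) ℂ) =
      Submodule.span ℝ {Complex.I • (1 : Matrix (Fin N) (Fin N) ℂ)} := by
    ext X
    rw [Submodule.mem_span_singleton]
    constructor
    · intro hX
      exact ⟨_, (skewCenter_matrix_complex hX ⟨0, hN⟩).symm⟩
    · rintro ⟨t, rfl⟩
      refine Submodule.smul_mem _ _ ⟨?_, fun Y _ => by simp⟩
      simp [star_smul]
  rw [this, finrank_span_singleton]
  intro h
  have := congrFun (congrFun h ⟨0, hN⟩) ⟨0, hN⟩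
  simp at this

theorem skewCenter_matrix_quaternion {N : ℕ} :
    skewCenter (Matrix (Fin N) (Fin N) ℍ[ℝ]) = ⊥ := by
  rw [Submodule.eq_bot_iff]
  intro X hX
  ext1 i j
  by_cases hij : i = j
  · subst hij
    have := skewCenter_matrix_diag_mem hX i
    rw [skewCenter_quaternion] at this
    exact this
  · refine skewCenter_matrix_offDiag hX (u := (⟨0, 1, 0, 0⟩ : ℍ[ℝ])) 
      (mem_unitaryLie_quaternion.2 rfl) ?_ hij
    intro x hx
    refine (mul_eq_zero.1 hx).resolve_left fun h => ?_
    have := congrArg QuaternionAlgebra.imI h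
    simp at this

/-- `dim u(M_N(D))`. -/
def DivKind.blockDim : DivKind → ℕ → ℕ
  | .real, N => N * (N - 1) / 2
  | .complex, N => N + N * (N - 1) / 2 * 2
  | .quaternion, N => N * 3 + N * (N - 1) / 2 * 4

/-- The dimension of the centre of `u(M_N(D))` for `N ≥ 1`. -/
def DivKind.blockCenter : DivKind → ℕ → ℕ
  | .real, N => if N = 2 then 1 else 0
  | .complex, _ => 1
  | .quaternion, _ => 0

theorem finrank_unitaryLie_block (k : DivKind) (N : ℕ) :
    Module.finrank ℝ (unitaryLie (Matrix (Fin N) (Fin N) k.carrier)).toSubmodule =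
      k.blockDim N := by
  rw [finrank_unitaryLie_matrix]
  cases k with
  | real =>
    have h : Module.finrank ℝ (unitaryLie DivKind.real.carrier).toSubmodule = 0 := by
      change Module.finrank ℝ (unitaryLie ℝ).toSubmodule = 0
      rw [unitaryLie_real, finrank_bot]
    have h' : Module.finrank ℝ DivKind.real.carrier = 1 := Module.finrank_self ℝ
    rw [h, h', mul_zero, zero_add, mul_one, DivKind.blockDim]
  | complex =>
    have h : Module.finrank ℝ (unitaryLie DivKind.complex.carrier).toSubmodule = 1 :=
      finrank_unitaryLie_complex
    have h' : Module.finrank ℝ DivKind.complex.carrier = 2 := Complex.finrank_real_complex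
    rw [h, h', mul_one, DivKind.blockDim]
  | quaternion =>
    have h : Module.finrank ℝ (unitaryLie DivKind.quaternion.carrier).toSubmodule = 3 :=
      finrank_unitaryLie_quaternion
    have h' : Module.finrank ℝ DivKind.quaternion.carrier = 4 := Quaternion.finrank_eq_four
    rw [h, h', DivKind.blockDim]

theorem finrank_skewCenter_block (k : DivKind) {N : ℕ} (hN : 0 < N) :
    Module.finrank ℝ (skewCenter (Matrix (Fin N) (Fin N) k.carrier)) = k.blockCenter N := by
  cases k with
  | real =>
    change Module.finrank ℝ (skewCenter (Matrix (Fin N) (Fin N) ℝ)) = if N = 2 then 1 else 0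
    split_ifs with h
    · subst h
      exact finrank_skewCenter_matrix_real_two
    · rw [skewCenter_matrix_real h, finrank_bot]
  | complex => exact finrank_skewCenter_matrix_complex hN
  | quaternion =>
    change Module.finrank ℝ (skewCenter (Matrix (Fin N) (Fin N) ℍ[ℝ])) = 0
    rw [skewCenter_matrix_quaternion, finrank_bot]

end Blocks

/-! ### Dimension and centre of su(n) -/

section SpecialUnitary

theorem finrank_uLie (n : ℕ) :
    Module.finrank ℝ (uLie n) = n + n * (n - 1) / 2 * 2 := finrank_unitaryLie_block .complex n

theorem mem_suLie {n : ℕ} {X : Matrix (Fin n) (Fin n) ℂ} :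
    X ∈ suLie n ↔ star X = -X ∧ X.trace = 0 := Iff.rfl

theorem trace_re_eq_zero {n : ℕ} {X : Matrix (Fin n) (Fin n) ℂ} (hX : star X = -X) :
    X.trace.re = 0 := by
  have h := Matrix.trace_conjTranspose X
  rw [← Matrix.star_eq_conjTranspose, hX, Matrix.trace_neg] at h
  have := congrArg Complex.re h
  simp at this
  linarith

/-- The trace on u(n) is purely imaginary, so tracelessness is one real condition; it fails at i·1.
-/
theorem finrank_suLie {n : ℕ} (hn : 0 < n) :
    Module.finrank ℝ (suLie n) + 1 = Module.finrank ℝ (uLie n) := by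
  let F : Matrix (Fin n) (Fin n) ℂ →ₗ[ℝ] ℝ := Complex.imLm ∘ₗ Matrix.traceLinearMap (Fin n) ℝ ℂ
  have h := finrank_eq_finrank_inf_ker_add_one (uLie n).toSubmodule F
    ⟨Complex.I • 1, by change star (Complex.I • (1 : Matrix (Fin n) (Fin n) ℂ)) = _; simp [star_smul],
      by simp [F, hn.ne']⟩
  have h1 : ((uLie n).toSubmodule ⊓ LinearMap.ker F) = (suLie n).toSubmodule := by
    ext X
    rw [Submodule.mem_inf, LinearMap.mem_ker]
    refine and_congr_right fun hX => ?_
    rw [Complex.ext_iff, trace_re_eq_zero hX]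
    simp [F]
  rw [h1] at h
  exact h.symm

/-- Every element of u(n) is traceless up to a multiple of 1, so X is central in u(n) as well. It is
then an imaginary scalar matrix, and trace zero kills it. -/
theorem eq_zero_of_forall_lie_suLie {n : ℕ} (hn : 0 < n) (X : suLie n)
    (h : ∀ Y : suLie n, ⁅X, Y⁆ = 0) : X = 0 := by
  obtain ⟨X, hX⟩ := X
  obtain ⟨hXs, hXt⟩ := mem_suLie.1 hX
  have hn' : (n : ℂ) ≠ 0 := by exact_mod_cast hn.ne'
  have hc : ∀ Y, star Y = -Y → Y.trace = 0 → X * Y = Y * X := by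
    intro Y hY hYt
    have := congrArg Subtype.val (h ⟨Y, hY, hYt⟩)
    exact sub_eq_zero.1 this
  have hmem : X ∈ skewCenter (Matrix (Fin n) (Fin n) ℂ) := by
    refine ⟨hXs, fun Y hY => ?_⟩
    have hre := trace_re_eq_zero hY
    have hst : star Y.trace = -Y.trace := by
      apply Complex.ext <;> simp [hre]
    have := hc (Y - (Y.trace / n) • 1) (by
      rw [star_sub, star_smul, hY, star_div₀, hst, star_one]
      simp
      module) (by simp [Matrix.trace_sub, hn'])
    simpa [mul_sub, sub_mul] using this
  have h1 := skewCenter_matrix_complex hmem ⟨0, hn⟩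
  have h2 := congrArg Matrix.trace h1
  rw [hXt] at h2
  simp [hn'] at h2
  refine Subtype.ext ?_
  change X = 0
  rw [h1, h2, zero_smul]

end SpecialUnitary

/-! ### From su(A) to u(A) -/

section Gauge

variable {A : Type*} [Ring A] [StarRing A] [Algebra ℝ A]
variable {H : Type*} [NormedAddCommGroup H] [InnerProductSpace ℂ H] [CompleteSpace H]

/-- The imaginary part of the trace over `H`. -/
noncomputable def reprTraceIm (π : A →⋆ₐ[ℝ] (H →L[ℂ] H)) : A →ₗ[ℝ] ℝ where
  toFun X := (reprTrace π X).im
  map_add' X Y := by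
    simp [reprTrace]
  map_smul' c X := by
    simp [reprTrace]

theorem reprTraceIm_mul_comm (π : A →⋆ₐ[ℝ] (H →L[ℂ] H)) (X Y : A) :
    reprTraceIm π (X * Y) = reprTraceIm π (Y * X) := by
  have h : ∀ X Y, ((π (X * Y) : H →L[ℂ] H) : H →ₗ[ℂ] H) =
      ((π X : H →L[ℂ] H) : H →ₗ[ℂ] H) * ((π Y : H →L[ℂ] H) : H →ₗ[ℂ] H) := by
    intro X Y
    rw [map_mul]
    rfl
  change (LinearMap.trace ℂ H _).im = (LinearMap.trace ℂ H _).im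
  rw [h, h, LinearMap.trace_mul_comm]

/-- The operator π X is skew-adjoint, so its diagonal entries in an orthonormal basis are imaginary.
The complex trace condition is thus a single real one. -/
theorem reprTrace_re_eq_zero [FiniteDimensional ℂ H] (π : A →⋆ₐ[ℝ] (H →L[ℂ] H)) {X : A}
    (hX : star X = -X) : (reprTrace π X).re = 0 := by
  have hadj : ContinuousLinearMap.adjoint (π X) = -π X := by
    rw [← ContinuousLinearMap.star_eq_adjoint, ← map_star, hX, map_neg]
  rw [reprTrace, LinearMap.trace_eq_sum_inner _ (stdOrthonormalBasis ℂ H), Complex.re_sum]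
  refine Finset.sum_eq_zero fun i _ => ?_
  set b := stdOrthonormalBasis ℂ H i
  have h1 : inner ℂ b (π X b) = -(starRingEnd ℂ) (inner ℂ b (π X b)) := by
    rw [inner_conj_symm, ← ContinuousLinearMap.adjoint_inner_left, hadj]
    simp
  have h2 := congrArg Complex.re h1
  simp only [Complex.neg_re, Complex.conj_re] at h2
  change (inner ℂ b (π X b)).re = 0
  linarith

theorem reprTrace_eq_zero_iff [FiniteDimensional ℂ H] (π : A →⋆ₐ[ℝ] (H →L[ℂ] H)) {X : A}
    (hX : star X = -X) : reprTrace π X = 0 ↔ reprTraceIm π X = 0 := by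
  rw [Complex.ext_iff, reprTrace_re_eq_zero π hX]
  change _ ↔ (reprTrace π X).im = 0
  simp

variable [StarModule ℝ A]

theorem mem_specialUnitaryLie [FiniteDimensional ℂ H] (π : A →⋆ₐ[ℝ] (H →L[ℂ] H)) {X : A} :
    X ∈ specialUnitaryLie π ↔ star X = -X ∧ reprTraceIm π X = 0 :=
  and_congr_right fun hX => reprTrace_eq_zero_iff π hX

variable [FiniteDimensional ℝ A] {τ : A →ₗ[ℝ] ℝ}

/-- Every functional on `u(A)` that vanishes on commutators is represented by a central element. -/
theorem IsPositiveTrace.exists_central (hτ : IsPositiveTrace τ) (F : A →ₗ[ℝ] ℝ)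
    (hF : ∀ X Y, F (X * Y) = F (Y * X)) :
    ∃ T ∈ skewCenter A, ∀ X, star X = -X → F X = -τ (T * X) := by
  let V := (unitaryLie A).toSubmodule
  let B : V →ₗ[ℝ] Module.Dual ℝ V :=
    LinearMap.mk₂ ℝ (fun X Y : V => -τ (X.1 * Y.1))
      (fun X X' Y => by simp [add_mul]; ring)
      (fun c X Y => by simp)
      (fun X Y Y' => by simp [mul_add]; ring)
      (fun c X Y => by simp)
  have hB : ∀ X Y : V, B X Y = -τ (X.1 * Y.1) := fun _ _ => rfl
  -- On u(A), -τ(X²) = τ(X*X), so the form -τ(XY) is positive definite.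
  have hnd : ∀ X : A, star X = -X → (∀ Y, star Y = -Y → τ (X * Y) = 0) → X = 0 := by
    intro X hX h
    apply hτ.eq_zero
    rw [hX, neg_mul, map_neg, h X hX, neg_zero]
  have hinj : Function.Injective B := by
    rw [injective_iff_map_eq_zero]
    rintro ⟨X, hX⟩ h
    refine Subtype.ext (hnd X hX fun Y hY => ?_)
    have := LinearMap.congr_fun h ⟨Y, hY⟩
    rw [hB] at this
    exact neg_eq_zero.1 this
  have hsurj := (LinearMap.injective_iff_surjective_of_finrank_eq_finrank
    (Subspace.dual_finrank_eq (K := ℝ) (V := V)).symm).1 hinj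
  obtain ⟨⟨T, hT⟩, hTF⟩ := hsurj (F.domRestrict V)
  have hTF' : ∀ X, star X = -X → F X = -τ (T * X) := fun X hX =>
    (LinearMap.congr_fun hTF ⟨X, hX⟩).symm
  have hlie : ∀ X Y : A, star X = -X → star Y = -Y → star (X * Y - Y * X) = -(X * Y - Y * X) := by
    intro X Y hX hY
    simp [hX, hY]
  refine ⟨T, ⟨hT, fun Y hY => ?_⟩, hTF'⟩
  -- By invariance, τ([T, Y]X) = τ(T[Y, X]) = -F([Y, X]) = 0 for every skew X, so [T, Y] = 0 by
  -- nondegeneracy.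
  refine sub_eq_zero.1 (hnd _ (hlie T Y hT hY) fun X hX => ?_)
  have h1 := hTF' _ (hlie Y X hY hX)
  rw [map_sub, hF X Y, sub_self] at h1
  have h2 : τ ((T * Y - Y * T) * X) = τ (T * (Y * X - X * Y)) := by
    rw [sub_mul, mul_sub, map_sub, map_sub, hτ.map_mul_comm (Y * T) X, ← mul_assoc, ← mul_assoc,
      hτ.map_mul_comm (X * Y) T]
  rw [h2]
  linarith

theorem finrank_unitaryLie_eq [FiniteDimensional ℂ H] (π : A →⋆ₐ[ℝ] (H →L[ℂ] H))
    (hπ : ∃ X ∈ unitaryLie A, reprTrace π X ≠ 0) :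
    Module.finrank ℝ (unitaryLie A).toSubmodule =
      Module.finrank ℝ (specialUnitaryLie π) + 1 := by
  obtain ⟨X, hX, hX0⟩ := hπ
  have : (unitaryLie A).toSubmodule ⊓ LinearMap.ker (reprTraceIm π) =
      (specialUnitaryLie π).toSubmodule := by
    ext X
    exact (mem_specialUnitaryLie π).symm
  rw [finrank_eq_finrank_inf_ker_add_one _ (reprTraceIm π)
    ⟨X, hX, fun h => hX0 ((reprTrace_eq_zero_iff π hX).2 h)⟩, this]
  rfl

/-- The trace functional is nonzero on the central element T representing it, so u(A) = su(A) ⊕ ℝT.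
The centre of u(A) is that of su(A) plus ℝT. -/
theorem finrank_skewCenter_eq [FiniteDimensional ℂ H] (hτ : IsPositiveTrace τ)
    (π : A →⋆ₐ[ℝ] (H →L[ℂ] H)) (hπ : ∃ X ∈ unitaryLie A, reprTrace π X ≠ 0) :
    Module.finrank ℝ (skewCenter A) =
      Module.finrank ℝ (LieAlgebra.center ℝ (specialUnitaryLie π)) + 1 := by
  obtain ⟨X, hX, hX0⟩ := hπ
  have hX1 : reprTraceIm π X ≠ 0 := fun h => hX0 ((reprTrace_eq_zero_iff π hX).2 h)
  obtain ⟨T, hT, hTF⟩ := hτ.exists_central (reprTraceIm π) (reprTraceIm_mul_comm π)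
  -- The value at T is τ(T*T); if it vanished, T and with it the whole functional on u(A) would be
  -- zero.
  have hT0 : reprTraceIm π T ≠ 0 := by
    intro h
    rw [hTF T hT.1, ← map_neg, ← neg_mul, ← hT.1] at h
    rw [hTF X hX, hτ.eq_zero T h, zero_mul, map_zero, neg_zero] at hX1
    exact hX1 rfl
  have h1 := (Submodule.equivMapOfInjective (specialUnitaryLie π).toSubmodule.subtype
    (Submodule.subtype_injective _)
    (LieAlgebra.center ℝ (specialUnitaryLie π)).toSubmodule).finrank_eq
  suffices h : skewCenter A ⊓ LinearMap.ker (reprTraceIm π) =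
      Submodule.map (specialUnitaryLie π).toSubmodule.subtype
        (LieAlgebra.center ℝ (specialUnitaryLie π)).toSubmodule by
    rw [finrank_eq_finrank_inf_ker_add_one _ (reprTraceIm π) ⟨T, hT, hT0⟩, h, ← h1]
    rfl
  ext Z
  simp only [Submodule.mem_inf, Submodule.mem_map, LinearMap.mem_ker]
  constructor
  · rintro ⟨hZ, hZ0⟩
    refine ⟨⟨Z, (mem_specialUnitaryLie π).2 ⟨hZ.1, hZ0⟩⟩, ?_, rfl⟩
    change _ ∈ LieAlgebra.center ℝ (specialUnitaryLie π)
    rw [LieModule.mem_maxTrivSubmodule]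
    intro Y
    exact Subtype.ext (sub_eq_zero.2 (hZ.2 Y.1 ((mem_specialUnitaryLie π).1 Y.2).1).symm)
  · rintro ⟨Z, hZ, rfl⟩
    have hZ' := (mem_specialUnitaryLie π).1 Z.2
    refine ⟨⟨hZ'.1, fun Y hY => ?_⟩, hZ'.2⟩
    have hZ := (LieModule.mem_maxTrivSubmodule ℝ (specialUnitaryLie π) (specialUnitaryLie π) Z).1 hZ
    -- Subtracting c T makes Y traceless without changing its commutator with Z.
    set c := reprTraceIm π Y / reprTraceIm π T with hc
    have hmem : Y - c • T ∈ specialUnitaryLie π := by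
      rw [mem_specialUnitaryLie]
      refine ⟨?_, ?_⟩
      · rw [star_sub, star_smul, hY, hT.1, star_trivial]; module
      · rw [map_sub, map_smul, smul_eq_mul, hc, div_mul_cancel₀ _ hT0, sub_self]
    have h2 := sub_eq_zero.1 (congrArg Subtype.val (hZ ⟨_, hmem⟩))
    have h3 := hT.2 Z.1 hZ'.1
    simp only [sub_mul, mul_sub, smul_mul_assoc, mul_smul_comm, h3] at h2
    exact (sub_left_inj.1 h2).symm

theorem finrank_center_eq_of_lieEquiv {L L' : Type*} [LieRing L] [LieAlgebra ℝ L] [LieRing L']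
    [LieAlgebra ℝ L'] (e : L ≃ₗ⁅ℝ⁆ L') :
    Module.finrank ℝ (LieAlgebra.center ℝ L) = Module.finrank ℝ (LieAlgebra.center ℝ L') := by
  refine finrank_submodule_eq (p := (LieAlgebra.center ℝ L).toSubmodule)
    (q := (LieAlgebra.center ℝ L').toSubmodule) e.toLinearEquiv fun x => ?_
  change x ∈ LieAlgebra.center ℝ L ↔ e x ∈ LieAlgebra.center ℝ L'
  rw [LieModule.mem_maxTrivSubmodule, LieModule.mem_maxTrivSubmodule]
  constructor
  · intro h y
    obtain ⟨y, rfl⟩ : ∃ y', e y' = y := ⟨e.symm y, by simp⟩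
    rw [← LieEquiv.map_lie, h, map_zero]
  · intro h y
    have h1 : e ⁅y, x⁆ = 0 := by rw [LieEquiv.map_lie, h]
    rw [← e.symm_apply_apply ⁅y, x⁆, h1, map_zero]

/-- Since su(3) and su(2) are centreless, the centre is the abelian factor u(1). -/
theorem finrank_center_standardModel :
    Module.finrank ℝ (LieAlgebra.center ℝ (suLie 3 × suLie 2 × uLie 1)) = 1 := by
  have hu : Module.finrank ℝ (uLie 1) = 1 := finrank_uLie 1
  have hcomm : ∀ X Y : uLie 1, ⁅X, Y⁆ = 0 := by
    intro X Y
    refine Subtype.ext (sub_eq_zero.2 ?_)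
    ext i j
    simp [Matrix.mul_apply, Subsingleton.elim i j, Subsingleton.elim j 0, mul_comm]
  have hz : ∀ Z, Z ∈ LieAlgebra.center ℝ (suLie 3 × suLie 2 × uLie 1) ↔ Z.1 = 0 ∧ Z.2.1 = 0 := by
    intro Z
    rw [LieModule.mem_maxTrivSubmodule]
    constructor
    · intro h
      refine ⟨eq_zero_of_forall_lie_suLie (by norm_num) _ fun Y => ?_,
        eq_zero_of_forall_lie_suLie (by norm_num) _ fun Y => ?_⟩
      · rw [← lie_skew, neg_eq_zero]
        exact congrArg Prod.fst (h (Y, 0, 0))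
      · rw [← lie_skew, neg_eq_zero]
        exact congrArg (fun W => W.2.1) (h (0, Y, 0))
    · rintro ⟨h1, h2⟩ Y
      refine Prod.ext ?_ (Prod.ext ?_ (hcomm _ _))
      · change ⁅Y.1, Z.1⁆ = 0
        rw [h1, lie_zero]
      · change ⁅Y.2.1, Z.2.1⁆ = 0
        rw [h2, lie_zero]
  let e : uLie 1 ≃ₗ[ℝ] LieAlgebra.center ℝ (suLie 3 × suLie 2 × uLie 1) :=
    { toFun := fun X => ⟨(0, 0, X), (hz _).2 ⟨rfl, rfl⟩⟩
      invFun := fun Z => Z.1.2.2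
      map_add' := fun X Y => Subtype.ext (by
        change ((0, 0, X + Y) : suLie 3 × suLie 2 × uLie 1) = (0, 0, X) + (0, 0, Y)
        simp)
      map_smul' := fun c X => Subtype.ext (by
        change ((0, 0, c • X) : suLie 3 × suLie 2 × uLie 1) = c • (0, 0, X)
        simp)
      left_inv := fun _ => rfl
      right_inv := fun Z => Subtype.ext (by
        have := (hz Z.1).1 Z.2
        exact Prod.ext this.1.symm (Prod.ext this.2.symm rfl)) }
  rw [← e.finrank_eq, hu]

theorem finrank_standardModel :
    Module.finrank ℝ (suLie 3 × suLie 2 × uLie 1) = 12 := by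
  have h1 := finrank_suLie (n := 3) (by norm_num)
  have h2 := finrank_suLie (n := 2) (by norm_num)
  rw [finrank_uLie] at h1 h2
  have (n : ℕ) : Module.Finite ℝ (suLie n) := inferInstanceAs (Module.Finite ℝ (suLie n).toSubmodule)
  have (n : ℕ) : Module.Finite ℝ (uLie n) := inferInstanceAs (Module.Finite ℝ (uLie n).toSubmodule)
  rw [Module.finrank_prod, Module.finrank_prod, finrank_uLie]
  omega

end Gauge

/-! ### Regrouping products of *-algebras -/

section StarEquivs

/-- The product of two `*`-isomorphisms. -/
def StarAlgEquiv.prodMap {A A' B B' : Type*} [Ring A] [StarRing A] [Algebra ℝ A]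
    [Ring A'] [StarRing A'] [Algebra ℝ A'] [Ring B] [StarRing B] [Algebra ℝ B]
    [Ring B'] [StarRing B'] [Algebra ℝ B'] (e : A ≃⋆ₐ[ℝ] A') (f : B ≃⋆ₐ[ℝ] B') :
    (A × B) ≃⋆ₐ[ℝ] (A' × B') :=
  .ofAlgEquiv (AlgEquiv.prodCongr e.toAlgEquiv f.toAlgEquiv) fun x =>
    Prod.ext (map_star e x.1) (map_star f x.2)

/-- Associativity of products of `*`-algebras. -/
def StarAlgEquiv.prodAssocSymm (A B C : Type*) [Ring A] [StarRing A] [Algebra ℝ A]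
    [Ring B] [StarRing B] [Algebra ℝ B] [Ring C] [StarRing C] [Algebra ℝ C] :
    (A × (B × C)) ≃⋆ₐ[ℝ] ((A × B) × C) where
  toFun x := ((x.1, x.2.1), x.2.2)
  invFun x := (x.1.1, (x.1.2, x.2))
  left_inv _ := rfl
  right_inv _ := rfl
  map_mul' _ _ := rfl
  map_add' _ _ := rfl
  map_star' _ := rfl
  map_smul' _ _ := rfl

/-- Splitting off one factor of a finite product of `*`-algebras. -/
def StarAlgEquiv.piSplitAt {C : Type*} [DecidableEq C] (j : C) (B : C → Type*) [∀ c, Ring (B c)]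
    [∀ c, StarRing (B c)] [∀ c, Algebra ℝ (B c)] :
    (∀ c, B c) ≃⋆ₐ[ℝ] (B j × ∀ c : {c // c ≠ j}, B c) where
  __ := Equiv.piSplitAt j B
  map_mul' _ _ := rfl
  map_add' _ _ := rfl
  map_star' _ := rfl
  map_smul' _ _ := rfl

/-- A `1 × 1` matrix is its entry. -/
def StarAlgEquiv.matrixFinOne (D : Type*) [Ring D] [StarRing D] [Algebra ℝ D] :
    Matrix (Fin 1) (Fin 1) D ≃⋆ₐ[ℝ] D where
  toFun M := M 0 0
  invFun d := Matrix.of fun _ _ => d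
  left_inv M := by
    ext i j
    rw [Subsingleton.elim i 0, Subsingleton.elim j 0]
    rfl
  right_inv _ := rfl
  map_mul' _ _ := by simp [Matrix.mul_apply]
  map_add' _ _ := rfl
  map_star' _ := rfl
  map_smul' _ _ := rfl

variable {A A' X X' B : Type*} [Ring A] [StarRing A] [Algebra ℝ A] [Ring A'] [StarRing A']
  [Algebra ℝ A'] [Ring X] [StarRing X] [Algebra ℝ X] [Ring X'] [StarRing X'] [Algebra ℝ X']
  [Ring B] [StarRing B] [Algebra ℝ B]

theorem IsoModuloReals.prod (e : A ≃⋆ₐ[ℝ] (X' × A')) (hX : Nonempty (X' ≃⋆ₐ[ℝ] X))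
    (h : IsoModuloReals A' B) : IsoModuloReals A (X × B) := by
  obtain ⟨f⟩ := hX
  obtain ⟨k, ⟨g⟩⟩ := h
  exact ⟨k, ⟨(e.trans (f.prodMap g)).trans (.prodAssocSymm _ _ _)⟩⟩

theorem IsoModuloReals.of_reals (e : A ≃⋆ₐ[ℝ] (X' × A')) (hX : Nonempty (X' ≃⋆ₐ[ℝ] X))
    (h : ∃ k : ℕ, Nonempty (A' ≃⋆ₐ[ℝ] (Fin k → ℝ))) : IsoModuloReals A X := by
  obtain ⟨f⟩ := hX
  obtain ⟨k, ⟨g⟩⟩ := h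
  exact ⟨k, ⟨e.trans (f.prodMap g)⟩⟩

theorem IsoModuloReals.of_equiv (e : A ≃⋆ₐ[ℝ] A') (h : IsoModuloReals A' B) :
    IsoModuloReals A B := by
  obtain ⟨k, ⟨g⟩⟩ := h
  exact ⟨k, ⟨e.trans g⟩⟩

end StarEquivs

/-! ### Arithmetic of the blocks -/

section Classification

namespace DivKind

/-- The algebra `M_N(D)`. -/
abbrev Block (k : DivKind) (N : ℕ) : Type := Matrix (Fin N) (Fin N) k.carrier

/-- The dimension of the semisimple part of `u(M_N(D))`. -/
def blockSemisimple (k : DivKind) (N : ℕ) : ℕ := k.blockDim N - k.blockCenter N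

/-- Dimensions grow with N, and the first excluded cases so(6), su(4), sp(3) have dimensions 15, 15,
21. -/
theorem block_cases {k : DivKind} {N : ℕ} (h : k.blockSemisimple N ≤ 11) :
    (k = real ∧ N ≤ 5) ∨ (k = complex ∧ N ≤ 3) ∨ (k = quaternion ∧ N ≤ 2) := by
  have hmono : ∀ n m, n ≤ m → n * (n - 1) / 2 ≤ m * (m - 1) / 2 := fun n m hnm =>
    Nat.div_le_div_right (Nat.mul_le_mul hnm (Nat.sub_le_sub_right hnm 1))
  cases k with
  | real =>
    refine Or.inl ⟨rfl, ?_⟩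
    by_contra! hlt
    have := hmono 6 N hlt
    simp only [blockSemisimple, blockDim, blockCenter] at h
    split_ifs at h <;> omega
  | complex =>
    refine Or.inr (Or.inl ⟨rfl, ?_⟩)
    by_contra! hlt
    have := hmono 4 N hlt
    simp only [blockSemisimple, blockDim, blockCenter] at h
    omega
  | quaternion =>
    refine Or.inr (Or.inr ⟨rfl, ?_⟩)
    by_contra! hlt
    have := hmono 3 N hlt
    simp only [blockSemisimple, blockDim, blockCenter] at h
    omega

/-- The subtraction in `blockSemisimple` is truncated. Positivity of N matters for ℂ, where
`blockCenter` is 1 even at N = 0. -/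
theorem blockDim_eq {k : DivKind} {N : ℕ} (hN : 0 < N) :
    k.blockDim N = k.blockSemisimple N + k.blockCenter N := by
  refine (Nat.sub_add_cancel ?_).symm
  cases k with
  | real =>
    simp only [blockDim, blockCenter]
    split_ifs with h
    · subst h; norm_num
    · exact Nat.zero_le _
  | complex => simp only [blockDim, blockCenter]; omega
  | quaternion => exact Nat.zero_le _

/-- The blocks whose semisimple part has dimension at most `11`. -/
theorem block_classification {k : DivKind} {N : ℕ} (hN : 0 < N) (h : k.blockSemisimple N ≤ 11) :
    (k.blockSemisimple N = 0 ∧ k.blockCenter N = 0 ∧ Nonempty (k.Block N ≃⋆ₐ[ℝ] ℝ)) ∨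
    (k.blockSemisimple N = 0 ∧ k.blockCenter N = 1 ∧
      (Nonempty (k.Block N ≃⋆ₐ[ℝ] ℂ) ∨ Nonempty (k.Block N ≃⋆ₐ[ℝ] Matrix (Fin 2) (Fin 2) ℝ))) ∨
    (k.blockSemisimple N = 3 ∧ k.blockCenter N = 0 ∧
      (Nonempty (k.Block N ≃⋆ₐ[ℝ] ℍ[ℝ]) ∨
        Nonempty (k.Block N ≃⋆ₐ[ℝ] Matrix (Fin 3) (Fin 3) ℝ))) ∨
    (k.blockSemisimple N = 3 ∧ k.blockCenter N = 1 ∧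
      Nonempty (k.Block N ≃⋆ₐ[ℝ] Matrix (Fin 2) (Fin 2) ℂ)) ∨
    (k.blockSemisimple N = 8 ∧ k.blockCenter N = 1 ∧
      Nonempty (k.Block N ≃⋆ₐ[ℝ] Matrix (Fin 3) (Fin 3) ℂ)) ∨
    k.blockSemisimple N = 6 ∨ k.blockSemisimple N = 10 := by
  obtain ⟨rfl, h5⟩ | ⟨rfl, h3⟩ | ⟨rfl, h2⟩ := block_cases h
  · interval_cases N
    · exact Or.inl ⟨rfl, rfl, ⟨StarAlgEquiv.matrixFinOne ℝ⟩⟩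
    · exact Or.inr (Or.inl ⟨rfl, rfl, Or.inr ⟨StarAlgEquiv.refl ℝ (Matrix (Fin 2) (Fin 2) ℝ)⟩⟩)
    · exact Or.inr (Or.inr (Or.inl ⟨rfl, rfl, Or.inr ⟨StarAlgEquiv.refl ℝ (Matrix (Fin 3) (Fin 3) ℝ)⟩⟩))
    -- M_4(ℝ) gives 6; M_5(ℝ) and M_2(ℍ) give 10. Only the numbers are kept, as these blocks never
    -- occur in the end.
    · exact Or.inr (Or.inr (Or.inr (Or.inr (Or.inr (Or.inl rfl)))))
    · exact Or.inr (Or.inr (Or.inr (Or.inr (Or.inr (Or.inr rfl)))))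
  · interval_cases N
    · exact Or.inr (Or.inl ⟨rfl, rfl, Or.inl ⟨StarAlgEquiv.matrixFinOne ℂ⟩⟩)
    · exact Or.inr (Or.inr (Or.inr (Or.inl ⟨rfl, rfl, ⟨StarAlgEquiv.refl ℝ (Matrix (Fin 2) (Fin 2) ℂ)⟩⟩)))
    · exact Or.inr (Or.inr (Or.inr (Or.inr (Or.inl
        ⟨rfl, rfl, ⟨StarAlgEquiv.refl ℝ (Matrix (Fin 3) (Fin 3) ℂ)⟩⟩))))
  · interval_cases N
    · exact Or.inr (Or.inr (Or.inl ⟨rfl, rfl, Or.inl ⟨StarAlgEquiv.matrixFinOne ℍ[ℝ]⟩⟩))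
    · exact Or.inr (Or.inr (Or.inr (Or.inr (Or.inr (Or.inr rfl)))))

end DivKind

theorem sum_subtype_ne_add {C : Type*} [Fintype C] [DecidableEq C] (f : C → ℕ) (j : C) :
    f j + ∑ c : {c // c ≠ j}, f c = ∑ c, f c := by
  rw [← Finset.add_sum_erase _ f (Finset.mem_univ j)]
  congr 1
  exact (Finset.sum_subtype _ (fun x => by simp) f).symm

section Families

variable {C : Type} [Fintype C] {k : C → DivKind} {N : C → ℕ}

theorem exists_equiv_reals (hN : ∀ c, 0 < N c) (hs : ∑ c, (k c).blockSemisimple (N c) = 0)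
    (hz : ∑ c, (k c).blockCenter (N c) = 0) :
    ∃ m : ℕ, Nonempty ((∀ c, (k c).Block (N c)) ≃⋆ₐ[ℝ] (Fin m → ℝ)) := by
  have h : ∀ c, Nonempty ((k c).Block (N c) ≃⋆ₐ[ℝ] ℝ) := by
    intro c
    have h1 : (k c).blockSemisimple (N c) = 0 := Finset.sum_eq_zero_iff.1 hs c (Finset.mem_univ c)
    have h2 : (k c).blockCenter (N c) = 0 := Finset.sum_eq_zero_iff.1 hz c (Finset.mem_univ c)
    have := DivKind.block_classification (hN c) (by omega : (k c).blockSemisimple (N c) ≤ 11)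
    rw [h1, h2] at this
    simpa using this
  have e := fun c => (h c).some
  let r := Fintype.equivFin C
  refine ⟨Fintype.card C, ⟨
    { toFun := fun x i => e (r.symm i) (x (r.symm i))
      invFun := fun y c => (e c).symm (y (r c))
      left_inv := fun x => by
        funext c
        obtain ⟨i, rfl⟩ := r.symm.surjective c
        change (e (r.symm i)).symm (e (r.symm (r (r.symm i))) (x (r.symm (r (r.symm i))))) = _
        rw [r.apply_symm_apply, StarAlgEquiv.symm_apply_apply]
      right_inv := fun y => by
        funext i
        change e _ ((e _).symm _) = _
        rw [StarAlgEquiv.apply_symm_apply, r.apply_symm_apply]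
      map_mul' := fun x y => funext fun i => map_mul (e _) _ _
      map_add' := fun x y => funext fun i => map_add (e _) _ _
      map_star' := fun x => funext fun i => map_star (e _) _
      map_smul' := fun c x => funext fun i => map_smul (e _) _ _ }⟩⟩

theorem isoModuloReals_of_abelian (hN : ∀ c, 0 < N c)
    (hs : ∑ c, (k c).blockSemisimple (N c) = 0) (hz : ∑ c, (k c).blockCenter (N c) = 1) :
    IsoModuloReals (∀ c, (k c).Block (N c)) ℂ ∨
      IsoModuloReals (∀ c, (k c).Block (N c)) (Matrix (Fin 2) (Fin 2) ℝ) := by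
  classical
  obtain ⟨j, -, hj⟩ := Finset.exists_ne_zero_of_sum_ne_zero (by rw [hz]; exact one_ne_zero)
  have hs' := sum_subtype_ne_add (fun c => (k c).blockSemisimple (N c)) j
  have hz' := sum_subtype_ne_add (fun c => (k c).blockCenter (N c)) j
  have hrest := exists_equiv_reals (k := fun c : {c // c ≠ j} => k c) (N := fun c => N c)
    (fun c => hN c) (by omega) (by omega)
  have e := StarAlgEquiv.piSplitAt j (fun c => (k c).Block (N c))
  obtain h | ⟨-, -, h | h⟩ | h | h | h | h | h :=
    DivKind.block_classification (hN j) (by omega : (k j).blockSemisimple (N j) ≤ 11)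
  · omega
  · exact Or.inl (.of_reals e h hrest)
  · exact Or.inr (.of_reals e h hrest)
  all_goals omega

/-- A block with nonzero semisimple part has dimension exactly 3 there. M_2(ℂ) also exhausts the
centre and leaves only copies of ℝ; ℍ and M_3(ℝ) are centreless and leave the central dimension to a
further ℂ or M_2(ℝ). -/
theorem isoModuloReals_of_three (hN : ∀ c, 0 < N c)
    (hs : ∑ c, (k c).blockSemisimple (N c) = 3) (hz : ∑ c, (k c).blockCenter (N c) = 1) :
    IsoModuloReals (∀ c, (k c).Block (N c)) (ℍ[ℝ] × Matrix (Fin 2) (Fin 2) ℝ) ∨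
    IsoModuloReals (∀ c, (k c).Block (N c))
      (Matrix (Fin 3) (Fin 3) ℝ × Matrix (Fin 2) (Fin 2) ℝ) ∨
    IsoModuloReals (∀ c, (k c).Block (N c)) (ℍ[ℝ] × ℂ) ∨
    IsoModuloReals (∀ c, (k c).Block (N c)) (Matrix (Fin 2) (Fin 2) ℂ) ∨
    IsoModuloReals (∀ c, (k c).Block (N c)) (Matrix (Fin 3) (Fin 3) ℝ × ℂ) := by
  classical
  obtain ⟨j, -, hj⟩ := Finset.exists_ne_zero_of_sum_ne_zero (by rw [hs]; exact three_ne_zero)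
  have hs' := sum_subtype_ne_add (fun c => (k c).blockSemisimple (N c)) j
  have hz' := sum_subtype_ne_add (fun c => (k c).blockCenter (N c)) j
  have e := StarAlgEquiv.piSplitAt j (fun c => (k c).Block (N c))
  obtain h | h | ⟨h1, h2, h⟩ | ⟨h1, h2, h⟩ | h | h | h :=
    DivKind.block_classification (hN j) (by omega : (k j).blockSemisimple (N j) ≤ 11)
  · omega
  · omega
  · have hrest := isoModuloReals_of_abelian (k := fun c : {c // c ≠ j} => k c) (N := fun c => N c)
      (fun c => hN c) (by omega) (by omega)
    rcases h with h | h <;> rcases hrest with hr | hr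
    · exact Or.inr (Or.inr (Or.inl (.prod e h hr)))
    · exact Or.inl (.prod e h hr)
    · exact Or.inr (Or.inr (Or.inr (Or.inr (.prod e h hr))))
    · exact Or.inr (Or.inl (.prod e h hr))
  · have hrest := exists_equiv_reals (k := fun c : {c // c ≠ j} => k c) (N := fun c => N c)
      (fun c => hN c) (by omega) (by omega)
    exact Or.inr (Or.inr (Or.inr (Or.inl (.of_reals e h hrest))))
  all_goals omega

/-- Without an 8 the summands are 0, 3, 6, 10. A 10 leaves a remainder of 1, which is not
attainable, and without a 10 the sum is divisible by 3, unlike 11. -/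
theorem exists_blockSemisimple_eq_eight (hN : ∀ c, 0 < N c)
    (hs : ∑ c, (k c).blockSemisimple (N c) = 11) : ∃ j, (k j).blockSemisimple (N j) = 8 := by
  classical
  by_contra! hne
  have hle : ∀ c, (k c).blockSemisimple (N c) ≤ 11 := fun c =>
    hs ▸ Finset.single_le_sum (f := fun c => (k c).blockSemisimple (N c))
      (fun _ _ => Nat.zero_le _) (Finset.mem_univ c)
  have hval : ∀ c, (k c).blockSemisimple (N c) = 0 ∨ (k c).blockSemisimple (N c) = 3 ∨
      (k c).blockSemisimple (N c) = 6 ∨ (k c).blockSemisimple (N c) = 10 := by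
    intro c
    have := hne c
    obtain h | h | h | h | h | h | h := DivKind.block_classification (hN c) (hle c) <;> omega
  by_cases h10 : ∃ j, (k j).blockSemisimple (N j) = 10
  · obtain ⟨j, hj⟩ := h10
    have hs' := sum_subtype_ne_add (fun c => (k c).blockSemisimple (N c)) j
    have h1 : ∑ c : {c // c ≠ j}, (k c).blockSemisimple (N c) = 1 := by omega
    have h0 : ∑ c : {c // c ≠ j}, (k c).blockSemisimple (N c) = 0 := by
      refine Finset.sum_eq_zero fun c _ => ?_
      have := Finset.single_le_sum (f := fun c : {c // c ≠ j} => (k c).blockSemisimple (N c))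
        (fun _ _ => Nat.zero_le _) (Finset.mem_univ c)
      have := hval c
      omega
    omega
  · push Not at h10
    have : 3 ∣ ∑ c, (k c).blockSemisimple (N c) := Finset.dvd_sum fun c _ => by
      have := hval c
      have := h10 c
      omega
    omega

theorem isoModuloReals_of_eleven (hN : ∀ c, 0 < N c)
    (hs : ∑ c, (k c).blockSemisimple (N c) = 11) (hz : ∑ c, (k c).blockCenter (N c) = 2) :
    IsoModuloReals (∀ c, (k c).Block (N c))
      (Matrix (Fin 3) (Fin 3) ℂ × ℍ[ℝ] × Matrix (Fin 2) (Fin 2) ℝ) ∨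
    IsoModuloReals (∀ c, (k c).Block (N c))
      (Matrix (Fin 3) (Fin 3) ℂ × Matrix (Fin 3) (Fin 3) ℝ × Matrix (Fin 2) (Fin 2) ℝ) ∨
    IsoModuloReals (∀ c, (k c).Block (N c)) (Matrix (Fin 3) (Fin 3) ℂ × ℍ[ℝ] × ℂ) ∨
    IsoModuloReals (∀ c, (k c).Block (N c))
      (Matrix (Fin 3) (Fin 3) ℂ × Matrix (Fin 2) (Fin 2) ℂ) ∨
    IsoModuloReals (∀ c, (k c).Block (N c))
      (Matrix (Fin 3) (Fin 3) ℂ × Matrix (Fin 3) (Fin 3) ℝ × ℂ) := by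
  classical
  obtain ⟨j, hj⟩ := exists_blockSemisimple_eq_eight hN hs
  have hs' := sum_subtype_ne_add (fun c => (k c).blockSemisimple (N c)) j
  have hz' := sum_subtype_ne_add (fun c => (k c).blockCenter (N c)) j
  have e := StarAlgEquiv.piSplitAt j (fun c => (k c).Block (N c))
  obtain h | h | h | h | ⟨-, h2, h⟩ | h | h :=
    DivKind.block_classification (hN j) (by omega : (k j).blockSemisimple (N j) ≤ 11)
  -- Goal 5 is M_3(ℂ), the only block with semisimple dimension 8; the rest has semisimple dimension
  -- 3 and centre 1.
  on_goal 5 =>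
    have hrest := isoModuloReals_of_three (k := fun c : {c // c ≠ j} => k c) (N := fun c => N c)
      (fun c => hN c) (by omega) (by omega)
    exact hrest.imp (.prod e h) (Or.imp (.prod e h) (Or.imp (.prod e h)
      (Or.imp (.prod e h) (.prod e h))))
  all_goals omega

end Families

end Classification

theorem mainTheorem8
    {A : Type*} [Ring A] [StarRing A] [Algebra ℝ A] [StarModule ℝ A] [FiniteDimensional ℝ A]
    (hA : IsMatrixStarAlgebra A)
    {H : Type*} [NormedAddCommGroup H] [InnerProductSpace ℂ H] [CompleteSpace H]
    [FiniteDimensional ℂ H]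
    (π : A →⋆ₐ[ℝ] (H →L[ℂ] H))
    (hπ : ∃ X ∈ unitaryLie A, reprTrace π X ≠ 0)
    (hsu : Nonempty (specialUnitaryLie π ≃ₗ⁅ℝ⁆ (suLie 3 × suLie 2 × uLie 1))) :
    IsoModuloReals A (Matrix (Fin 3) (Fin 3) ℂ × ℍ[ℝ] × Matrix (Fin 2) (Fin 2) ℝ) ∨
    IsoModuloReals A
      (Matrix (Fin 3) (Fin 3) ℂ × Matrix (Fin 3) (Fin 3) ℝ × Matrix (Fin 2) (Fin 2) ℝ) ∨
    IsoModuloReals A (Matrix (Fin 3) (Fin 3) ℂ × ℍ[ℝ] × ℂ) ∨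
    IsoModuloReals A (Matrix (Fin 3) (Fin 3) ℂ × Matrix (Fin 2) (Fin 2) ℂ) ∨
    IsoModuloReals A (Matrix (Fin 3) (Fin 3) ℂ × Matrix (Fin 3) (Fin 3) ℝ × ℂ) := by
  obtain ⟨τ, hτ⟩ := hA.exists_isPositiveTrace
  obtain ⟨e⟩ := hsu
  have ht := finrank_unitaryLie_eq π hπ
  have hz := finrank_skewCenter_eq hτ π hπ
  rw [e.toLinearEquiv.finrank_eq, finrank_standardModel] at ht
  rw [finrank_center_eq_of_lieEquiv e, finrank_center_standardModel] at hz
  obtain ⟨C, _, k, N, hN, ⟨f⟩⟩ := exists_starAlgEquiv_pi_matrix hA.hasRealSpectra hτ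
  rw [f.finrank_unitaryLie_eq, finrank_unitaryLie_pi] at ht
  rw [f.finrank_skewCenter_eq, finrank_skewCenter_pi] at hz
  simp only [finrank_unitaryLie_block, finrank_skewCenter_block _ (hN _)] at ht hz
  -- The total is 12 + 1 = 13, of which the centres account for 1 + 1 = 2, leaving 11.
  simp only [DivKind.blockDim_eq (hN _), Finset.sum_add_distrib, hz] at ht
  exact (isoModuloReals_of_eleven hN (by omega) hz).imp (.of_equiv f) (Or.imp (.of_equiv f)
    (Or.imp (.of_equiv f) (Or.imp (.of_equiv f) (.of_equiv f))))
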